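/- Let $\mathcal X,\mathcal S,\mathcal Y,\mathcal Z,\hat{\mathcal S}$ be finite alphabets with $\hat{\mathcal S}\neq\emptyset$, let $P_S$ be a pmf on $\mathcal S$, let $p(y,z|x,s)$ be a conditional pmf on $\mathcal Y\times\mathcal Z$ given $(x,s)\in\mathcal X\times\mathcal S$, and let $d:\mathcal S\times\hat{\mathcal S}\to[0,\infty)$ be a distortion function. A message $W$, uniform on a set of $\lceil 2^{nR}\rceil$ messages ($R\ge 0$), is encoded into $x^n(W)\in\mathcal X^n$ and sent over the memoryless channel $p(y,z|x,s)$ whose state sequence $S^n$ is i.i.d. $\sim P_S$ and independent of $W$. The communication receiver decodes $W$ from $(Y^n,S^n)$; the sensing receiver decodes the whole of $W$ from $Z^n$ (full decoding), and also forms an estimate $\hat S^n=h_n(Z^n)\in\hat{\mathcal S}^n$. The pair $(R,D)$ is achievable if there is a sequence of such codes, $n\to\infty$, for which the probability that at least one of the two decoders errs tends to $0$ and $\varlimsup_{n\to\infty}\frac1n\sum_{i=1}^n\mathbb E[d(S_i,\hat S_i)]\le D$. Let $\mathcal C$ be the closure in $\mathbb R^2$ of the set of achievable pairs, and let $C(D)=\sup\{R:(R,D)\in\mathcal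 C\}$. For an input law $P_X$ let $(S,X,Y,Z)$ have the joint law $P_XP_SP_{YZ|XS}$, and let $\hat s^*(x,z)\in\arg\min_{s'\in\hat{\mathcal S}}\sum_{s\in\mathcal S}P_{S|XZ}(s|x,z)\,d(s,s')$, where $P_{S|XZ}(s|x,z)=P_S(s)P_{Z|XS}(z|x,s)/\sum_{\tilde s}P_S(\tilde s)P_{Z|XS}(z|x,\tilde s)$. Put $c(x)=\mathbb E[d(S,\hat s^*(X,Z))\mid X=x]$ and $\mathcal P_D=\{P_X:\sum_xP_X(x)c(x)\le D\}$. Then for every real $D$ there is some $R$ with $(R,D)\in\mathcal C$ if and only if $\mathcal P_D\ne\emptyset$; and in that case the supremum defining $C(D)$ is attained, and $$C(D)=\max_{P_X\in\mathcal P_D}\min\{I(X;Y|S),\,I(X;Z)\},$$ where the maximum is attained and mutual informations are in bits. -/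

import Mathlib

open Filter Topology

noncomputable section

namespace ISAC

/-! ### Information measures of finite probability mass functions (in bits) -/

/-- Mutual information `I(A;B)` of a pair with joint pmf `q`. -/
def mutualInfo {A B : Type*} [Fintype A] [Fintype B] (q : A → B → ℝ) : ℝ :=
  ∑ a, ∑ b, q a b * Real.logb 2 (q a b / ((∑ b', q a b') * ∑ a', q a' b))

/-- Conditional mutual information `I(A;B|C)` of a triple with joint pmf `q`. -/
def condMutualInfo {A B C : Type*} [Fintype A] [Fintype B] [Fintype C]
    (q : A → B → C → ℝ) : ℝ :=
  ∑ a, ∑ b, ∑ c, q a b c *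
    Real.logb 2 ((q a b c * ∑ a', ∑ b', q a' b' c) / ((∑ b', q a b' c) * ∑ a', q a' b c))

/-! ### The channel -/

/-- A two-receiver state-dependent memoryless channel with input alphabet `X`, state alphabet `S`
and output alphabets `Y` (communication receiver) and `Z` (sensing receiver): a state pmf `P_S`
and a transition pmf `p(y,z|x,s)`. -/
structure Channel (X S Y Z : Type*) [Fintype X] [Fintype S] [Fintype Y] [Fintype Z] where
  /-- The state pmf `P_S`. -/
  stateLaw : S → ℝ
  stateLaw_mem : stateLaw ∈ stdSimplex ℝ S
  /-- `trans x s (y, z) = p(y,z|x,s)`. -/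
  trans : X → S → Y × Z → ℝ
  trans_mem : ∀ x s, trans x s ∈ stdSimplex ℝ (Y × Z)

/-- A code of block length `n` with `M₀` public and `M₁` private messages. The communication
receiver observes `(yⁿ, sⁿ)` and decodes both messages; the sensing receiver observes `zⁿ`, decodes
the public message and estimates the state sequence (with reconstruction alphabet `T`). -/
structure Code (X S Y Z T : Type*) (M₀ M₁ n : ℕ) where
  /-- The codeword `xⁿ(w₀, w₁)`. -/
  enc : Fin M₀ × Fin M₁ → Fin n → X
  /-- Decoder of the communication receiver. -/
  dec₁ : (Fin n → Y) → (Fin n → S) → Fin M₀ × Fin M₁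
  /-- Decoder of the sensing receiver. -/
  dec₂ : (Fin n → Z) → Fin M₀
  /-- State estimator of the sensing receiver. -/
  est : (Fin n → Z) → Fin n → T

section Operational

variable {X S Y Z T : Type*} [Fintype X] [Fintype S] [Fintype Y] [Fintype Z]

namespace Code

variable {M₀ M₁ n : ℕ}

/-- The joint pmf of the uniform message pair, the i.i.d. state sequence and the two output
sequences of the memoryless channel, when the code `c` is used. -/
def law (c : Code X S Y Z T M₀ M₁ n) (ch : Channel X S Y Z)
    (w : Fin M₀ × Fin M₁) (s : Fin n → S) (y : Fin n → Y) (z : Fin n → Z) : ℝ :=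
  ((M₀ : ℝ) * M₁)⁻¹ * ∏ i, ch.stateLaw (s i) * ch.trans (c.enc w i) (s i) (y i, z i)

/-- The average probability that at least one of the two decoders is wrong. -/
def errorProb (c : Code X S Y Z T M₀ M₁ n) (ch : Channel X S Y Z) : ℝ :=
  ∑ w, ∑ s, ∑ y, ∑ z,
    if c.dec₁ y s ≠ w ∨ c.dec₂ z ≠ w.1 then c.law ch w s y z else 0

/-- The expected average per-block distortion `(1/n) ∑ᵢ E[d(Sᵢ, Ŝᵢ)]`. -/
def distortion (c : Code X S Y Z T M₀ M₁ n) (ch : Channel X S Y Z) (d : S → T → ℝ) : ℝ :=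
  (n : ℝ)⁻¹ * ∑ i, ∑ w, ∑ s, ∑ y, ∑ z, c.law ch w s y z * d (s i) (c.est z i)

end Code

/-- The number of messages of a message set `[1 : 2^(nR)]`, rounded up to an integer. -/
def numMessages (n : ℕ) (R : ℝ) : ℕ := ⌈(2 : ℝ) ^ ((n : ℝ) * R)⌉₊

/-- The rate-distortion tuple `(R₀, R₁, D)` is achievable: there is a sequence of
`(2^(nR₀), 2^(nR₁), n)` codes whose error probability vanishes and whose distortion has limit
superior at most `D`. -/
def Achievable (ch : Channel X S Y Z) (d : S → T → ℝ) (R₀ R₁ D : ℝ) : Prop :=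
  0 ≤ R₀ ∧ 0 ≤ R₁ ∧
  ∃ c : ∀ n : ℕ, Code X S Y Z T (numMessages n R₀) (numMessages n R₁) n,
    Tendsto (fun n => (c n).errorProb ch) atTop (𝓝 0) ∧
    limsup (fun n => (c n).distortion ch d) atTop ≤ D

/-- The capacity-distortion region under full-decoding-based estimation: the closure of the set of
pairs `(R, D)` that are achievable when the whole message is public (`R₀ = R`, `R₁ = 0`), so that
both receivers have to decode all of it. -/
def fullDecodingRegion (ch : Channel X S Y Z) (d : S → T → ℝ) : Set (ℝ × ℝ) :=
  closure {p : ℝ × ℝ | Achievable ch d p.1 0 p.2}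

/-- The rates that are possible at distortion level `D` under full-decoding-based estimation. -/
def fullDecodingRates (ch : Channel X S Y Z) (d : S → T → ℝ) (D : ℝ) : Set ℝ :=
  {R : ℝ | (R, D) ∈ fullDecodingRegion ch d}

/-- The capacity-distortion tradeoff `C(D)` under full-decoding-based estimation. -/
def capacity (ch : Channel X S Y Z) (d : S → T → ℝ) (D : ℝ) : ℝ :=
  sSup (fullDecodingRates ch d D)

end Operational

section SingleLetter

variable {X S Y Z T : Type*} [Fintype X] [Fintype S] [Fintype Y] [Fintype Z]

/-- The single-letter joint pmf `P_X(x) P_S(s) p(y,z|x,s)`. -/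
def joint (ch : Channel X S Y Z) (P : X → ℝ) (x : X) (s : S) (y : Y) (z : Z) : ℝ :=
  P x * ch.stateLaw s * ch.trans x s (y, z)

/-- `I(X;Y|S)` under the joint pmf `P_X P_S P_{YZ|XS}`. -/
def infoXYgivenS (ch : Channel X S Y Z) (P : X → ℝ) : ℝ :=
  condMutualInfo fun (x : X) (y : Y) (s : S) => ∑ z, joint ch P x s y z

/-- `I(X;Z)` under the joint pmf `P_X P_S P_{YZ|XS}`. -/
def infoXZ (ch : Channel X S Y Z) (P : X → ℝ) : ℝ :=
  mutualInfo fun (x : X) (z : Z) => ∑ s, ∑ y, joint ch P x s y z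

/-- `P_{Z|XS}(z|x,s)`. -/
def transZ (ch : Channel X S Y Z) (x : X) (s : S) (z : Z) : ℝ :=
  ∑ y, ch.trans x s (y, z)

/-- The posterior state probability `P_{S|XZ}(s|x,z)` (Bayes' rule; `0` for outputs `z` that have
probability zero under the input `x`). -/
def posterior (ch : Channel X S Y Z) (x : X) (z : Z) (s : S) : ℝ :=
  ch.stateLaw s * transZ ch x s z / ∑ s', ch.stateLaw s' * transZ ch x s' z

/-- The optimal estimator `ŝ*(x,z)`, a minimizer over `s'` of `∑ₛ P_{S|XZ}(s|x,z) d(s,s')`. -/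
def optEstimator [Finite T] [Nonempty T] (ch : Channel X S Y Z) (d : S → T → ℝ)
    (x : X) (z : Z) : T :=
  Classical.choose (Finite.exists_min fun t : T => ∑ s, posterior ch x z s * d s t)

theorem optEstimator_spec [Finite T] [Nonempty T] (ch : Channel X S Y Z) (d : S → T → ℝ)
    (x : X) (z : Z) (t : T) :
    ∑ s, posterior ch x z s * d s (optEstimator ch d x z) ≤ ∑ s, posterior ch x z s * d s t :=
  Classical.choose_spec (Finite.exists_min fun t : T => ∑ s, posterior ch x z s * d s t) t

/-- The cost `c(x) = E[d(S, ŝ*(X,Z)) | X = x]`. -/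
def cost [Finite T] [Nonempty T] (ch : Channel X S Y Z) (d : S → T → ℝ) (x : X) : ℝ :=
  ∑ s, ∑ z, ch.stateLaw s * transZ ch x s z * d s (optEstimator ch d x z)

/-- The set `𝒫_D` of input pmfs whose expected cost is at most `D`. -/
def inputLaws [Finite T] [Nonempty T] (ch : Channel X S Y Z) (d : S → T → ℝ) (D : ℝ) :
    Set (X → ℝ) :=
  {P | P ∈ stdSimplex ℝ X ∧ ∑ x, P x * cost ch d x ≤ D}

end SingleLetter

end ISAC

end

/-!
The capacity-distortion tradeoff with full decoding is a problem with two point-to-point channels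
that share the codebook: `commChannel`, from the input to `(y, s)`, with mutual information
`I(X;Y|S)` because the state is independent of the input, and `sensChannel`, from the input to `z`,
with mutual information `I(X;Z)`.

Converse. Two laws of message and channel output are compared: the true one, and the one under
which the output is i.i.d., independent of the message, with the output law of the empirical input
law `P` of the code. Their divergence is exactly `n I(P, V)`, while a decoder is correct with
probability `1 / M` under the second law, so the Donsker–Varadhan inequality gives a Fano-type bound
without chain rules or concavity (`one_sub_avgError_mul_log_card_le`). Given the message, the
letters are independent over time, so no estimator has smaller distortion than the optimal
single-letter estimator that knows the codeword; the distortion is thus at least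
`∑ x, P x * cost x` (`Code.sum_empLaw_mul_cost_le_distortion`). A limit point of the empirical input
laws then satisfies the single-letter constraints, and these define a closed region because the
simplex is compact.

Achievability. For i.i.d. codebooks and maximum likelihood decoding, the mean error probability
vanishes at all rates below the mutual information (`exists_tendsto_sum_avgError_le`): a one-shot
threshold bound is combined with a Chernoff bound for the likelihood ratio. The sensing receiver
decodes the codeword and applies the optimal single-letter estimator, so its mean distortion is at
most `∑ x, P x * cost x` plus a multiple of the mean error probability. One codebook with both
properties is found by averaging a weighted sum of the two (`achievable_of_lt_info`).
-/

namespace ISAC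

/-! ### Sums of products over tuples -/

section Tuples

variable {ι B : Type*} [Fintype ι] [DecidableEq ι] [Fintype B]

theorem sum_pi_prod (f : ι → B → ℝ) : ∑ b : ι → B, ∏ i, f i (b i) = ∏ i, ∑ b, f i b :=
  (Fintype.prod_sum f).symm

theorem sum_pi_prod_mul_coord (p : ι → B → ℝ) (i : ι) (φ : B → ℝ) :
    ∑ b : ι → B, (∏ j, p j (b j)) * φ (b i) =
      (∏ j ∈ Finset.univ.erase i, ∑ b, p j b) * ∑ b, p i b * φ b := by
  have h : ∀ b : ι → B, (∏ j, p j (b j)) * φ (b i) =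
      ∏ j, (p j (b j) * if j = i then φ (b j) else 1) := by
    intro b
    rw [Finset.prod_mul_distrib, Finset.prod_ite_eq' Finset.univ i (fun j => φ (b j))]
    simp
  rw [Finset.sum_congr rfl fun b _ => h b,
    sum_pi_prod (fun j a => p j a * if j = i then φ a else 1),
    ← Finset.prod_erase_mul _ _ (Finset.mem_univ i)]
  congr 1
  · refine Finset.prod_congr rfl fun j hj => ?_
    simp [Finset.ne_of_mem_erase hj]
  · simp

theorem sum_pi_prod_mul_coord_of_sum_eq_one (p : ι → B → ℝ) (hp : ∀ j, ∑ b, p j b = 1) (i : ι)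
    (φ : B → ℝ) :
    ∑ b : ι → B, (∏ j, p j (b j)) * φ (b i) = ∑ b, p i b * φ b := by
  rw [sum_pi_prod_mul_coord, Finset.prod_eq_one fun j _ => hp j, one_mul]

theorem sum_pi_prod_mul_two_coords (p : B → ℝ) (hp : ∑ b, p b = 1) {i j : ι} (hij : i ≠ j)
    (φ ψ : B → ℝ) :
    ∑ b : ι → B, (∏ k, p (b k)) * (φ (b i) * ψ (b j)) =
      (∑ b, p b * φ b) * ∑ b, p b * ψ b := by
  have h : ∀ b : ι → B, (∏ k, p (b k)) * (φ (b i) * ψ (b j)) =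
      (∏ k, (p (b k) * if k = j then ψ (b k) else 1)) * φ (b i) := by
    intro b
    rw [Finset.prod_mul_distrib, Finset.prod_ite_eq' Finset.univ j (fun k => ψ (b k))]
    simp
    ring
  rw [Finset.sum_congr rfl fun b _ => h b,
    sum_pi_prod_mul_coord (fun k a => p a * if k = j then ψ a else 1) i φ, mul_comm]
  congr 1
  · simp [hij]
  · rw [← Finset.mul_prod_erase _ _ (Finset.mem_erase.2 ⟨hij.symm, Finset.mem_univ j⟩)]
    rw [Finset.prod_eq_one, mul_one]
    · simp
    · intro k hk
      simp [Finset.ne_of_mem_erase hk, hp]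

end Tuples

/-! ### Mutual information of a channel -/

section Info

variable {A B : Type*} [Fintype A]

/-- The output law of the channel `V` under the input law `P`. -/
noncomputable def outLaw (P : A → ℝ) (V : A → B → ℝ) (b : B) : ℝ := ∑ a, P a * V a b

theorem outLaw_nonneg {P : A → ℝ} {V : A → B → ℝ} (hP : ∀ a, 0 ≤ P a) (hV : ∀ a b, 0 ≤ V a b)
    (b : B) : 0 ≤ outLaw P V b :=
  Finset.sum_nonneg fun a _ => mul_nonneg (hP a) (hV a b)

theorem outLaw_pos {P : A → ℝ} {V : A → B → ℝ} (hP : ∀ a, 0 ≤ P a) (hV : ∀ a b, 0 ≤ V a b)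
    {a : A} {b : B} (ha : 0 < P a) (hb : 0 < V a b) : 0 < outLaw P V b :=
  Finset.sum_pos' (fun a _ => mul_nonneg (hP a) (hV a b)) ⟨a, Finset.mem_univ a, mul_pos ha hb⟩

variable [Fintype B]

/-- The mutual information `I(P, V)`, in bits, between the input and the output of the channel `V`
under the input law `P`. It is written as output entropy minus conditional entropy, so that it
is continuous in `P` on the whole space. -/
noncomputable def info (P : A → ℝ) (V : A → B → ℝ) : ℝ :=
  ((∑ b, Real.negMulLog (outLaw P V b)) - ∑ a, P a * ∑ b, Real.negMulLog (V a b)) / Real.log 2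

theorem continuous_info (V : A → B → ℝ) : Continuous fun P : A → ℝ => info P V := by
  unfold info outLaw
  refine Continuous.div_const (Continuous.sub ?_ ?_) _
  · exact continuous_finsetSum _ fun b _ => Real.continuous_negMulLog.comp (by fun_prop)
  · fun_prop

theorem info_mul_log_two (P : A → ℝ) (V : A → B → ℝ) :
    info P V * Real.log 2 =
      ∑ a, ∑ b, P a * V a b * (Real.log (V a b) - Real.log (outLaw P V b)) := by
  have h2 : Real.log 2 ≠ 0 := (Real.log_pos one_lt_two).ne'
  have h1 : ∑ b, Real.negMulLog (outLaw P V b) =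
      -∑ a, ∑ b, P a * V a b * Real.log (outLaw P V b) := by
    rw [Finset.sum_comm, ← Finset.sum_neg_distrib]
    refine Finset.sum_congr rfl fun b _ => ?_
    rw [← Finset.sum_mul, Real.negMulLog, outLaw, neg_mul]
  have h3 : ∑ a, P a * ∑ b, Real.negMulLog (V a b) =
      -∑ a, ∑ b, P a * V a b * Real.log (V a b) := by
    rw [← Finset.sum_neg_distrib]
    refine Finset.sum_congr rfl fun a _ => ?_
    rw [Finset.mul_sum, ← Finset.sum_neg_distrib]
    refine Finset.sum_congr rfl fun b _ => ?_
    rw [Real.negMulLog]; ring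
  rw [info, div_mul_cancel₀ _ h2, h1, h3]
  simp only [mul_sub, Finset.sum_sub_distrib]
  ring

theorem sum_outLaw {P : A → ℝ} {V : A → B → ℝ} (hP : ∑ a, P a = 1) (hV : ∀ a, ∑ b, V a b = 1) :
    ∑ b, outLaw P V b = 1 := by
  unfold outLaw
  rw [Finset.sum_comm]
  simp [← Finset.mul_sum, hV, hP]

theorem info_nonneg {P : A → ℝ} {V : A → B → ℝ} (hP : P ∈ stdSimplex ℝ A)
    (hV : ∀ a, V a ∈ stdSimplex ℝ B) : 0 ≤ info P V := by
  have h2 : 0 < Real.log 2 := Real.log_pos one_lt_two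
  refine nonneg_of_mul_nonneg_left ?_ h2
  rw [info_mul_log_two]
  have key : ∑ a, ∑ b, P a * (V a b - outLaw P V b) = 0 := by
    simp [← Finset.mul_sum, sum_outLaw hP.2 fun a => (hV a).2, (hV _).2]
  rw [← key]
  refine Finset.sum_le_sum fun a _ => Finset.sum_le_sum fun b _ => ?_
  rcases (hP.1 a).eq_or_lt with ha | ha
  · simp [← ha]
  rcases ((hV a).1 b).eq_or_lt with hb | hb
  · rw [← hb]
    have := mul_nonneg ha.le (outLaw_nonneg hP.1 (fun a b => (hV a).1 b) b)
    simp [this]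
  have hQ := outLaw_pos hP.1 (fun a b => (hV a).1 b) ha hb
  rw [mul_assoc]
  refine mul_le_mul_of_nonneg_left ?_ ha.le
  have := Real.log_le_sub_one_of_pos (div_pos hQ hb)
  rw [Real.log_div hQ.ne' hb.ne'] at this
  have h3 : V a b * (Real.log (outLaw P V b) - Real.log (V a b)) ≤
      V a b * (outLaw P V b / V a b - 1) := mul_le_mul_of_nonneg_left this hb.le
  have h4 : V a b * (outLaw P V b / V a b - 1) = outLaw P V b - V a b := by
    field_simp
  linarith

theorem mutualInfo_eq_info {P : A → ℝ} {V : A → B → ℝ} (hP : ∀ a, 0 ≤ P a)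
    (hV : ∀ a, V a ∈ stdSimplex ℝ B) : mutualInfo (fun a b => P a * V a b) = info P V := by
  have h2 : Real.log 2 ≠ 0 := (Real.log_pos one_lt_two).ne'
  rw [← mul_div_cancel_right₀ (info P V) h2, info_mul_log_two, mutualInfo, Finset.sum_div]
  refine Finset.sum_congr rfl fun a _ => ?_
  rw [Finset.sum_div]
  refine Finset.sum_congr rfl fun b _ => ?_
  rcases (hP a).eq_or_lt with ha | ha
  · simp [← ha]
  rcases ((hV a).1 b).eq_or_lt with hb | hb
  · simp [← hb]
  have hQ := outLaw_pos hP (fun a b => (hV a).1 b) ha hb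
  have : ∑ b', P a * V a b' = P a := by rw [← Finset.mul_sum, (hV a).2, mul_one]
  rw [this, Real.logb, mul_div_mul_left _ _ ha.ne']
  change P a * V a b * (Real.log (V a b / outLaw P V b) / Real.log 2) = _
  rw [Real.log_div hb.ne' hQ.ne']
  ring

/-- If a component `C` of the output is independent of the input, then `I(A;B|C) = I(A;BC)`. -/
theorem condMutualInfo_eq_info {C : Type*} [Fintype C] {P : A → ℝ} {V : A → B × C → ℝ} {r : C → ℝ}
    (hP : P ∈ stdSimplex ℝ A) (hV : ∀ a b, 0 ≤ V a b) (hr : ∀ a c, ∑ b, V a (b, c) = r c) :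
    condMutualInfo (fun a b c => P a * V a (b, c)) = info P V := by
  have h2 : Real.log 2 ≠ 0 := (Real.log_pos one_lt_two).ne'
  rw [← mul_div_cancel_right₀ (info P V) h2, info_mul_log_two, condMutualInfo, Finset.sum_div]
  refine Finset.sum_congr rfl fun a _ => ?_
  rw [Fintype.sum_prod_type, Finset.sum_div]
  refine Finset.sum_congr rfl fun b _ => ?_
  rw [Finset.sum_div]
  refine Finset.sum_congr rfl fun c _ => ?_
  rcases (hP.1 a).eq_or_lt with ha | ha
  · simp [← ha]
  rcases (hV a (b, c)).eq_or_lt with hb | hb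
  · simp [← hb]
  have hQ := outLaw_pos hP.1 hV ha hb
  have hrc : 0 < r c := by
    rw [← hr a c]
    exact Finset.sum_pos' (fun b _ => hV a (b, c)) ⟨b, Finset.mem_univ b, hb⟩
  simp only [← Finset.mul_sum, hr, ← Finset.sum_mul, hP.2, one_mul]
  rw [Real.logb]
  change P a * V a (b, c) *
    (Real.log (P a * V a (b, c) * r c / (P a * r c * outLaw P V (b, c))) / Real.log 2) = _
  rw [show P a * V a (b, c) * r c = P a * r c * V a (b, c) by ring,
    mul_div_mul_left _ _ (mul_pos ha hrc).ne', Real.log_div hb.ne' hQ.ne']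
  ring

end Info

/-! ### Block channels, message sets and error probabilities -/

section Block

/-- The `n`-fold memoryless extension of the channel `V`. -/
def blockChannel {A B : Type*} (V : A → B → ℝ) (n : ℕ) (x : Fin n → A) (b : Fin n → B) : ℝ :=
  ∏ i, V (x i) (b i)

theorem blockChannel_mem {A B : Type*} [Fintype B] {V : A → B → ℝ}
    (hV : ∀ a, V a ∈ stdSimplex ℝ B) (n : ℕ) (x : Fin n → A) :
    blockChannel V n x ∈ stdSimplex ℝ (Fin n → B) := by
  refine ⟨fun b => Finset.prod_nonneg fun i _ => (hV _).1 _, ?_⟩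
  unfold blockChannel
  rw [sum_pi_prod fun i => V (x i)]
  exact Finset.prod_eq_one fun i _ => (hV _).2

/-- The average error probability of the decoder `g` for the codebook `x` on the channel `V`,
for a message uniform on `W`. -/
noncomputable def avgError {A B W : Type*} [Fintype B] [Fintype W] [DecidableEq W]
    (V : A → B → ℝ) (x : W → A) (g : B → W) : ℝ :=
  (Fintype.card W : ℝ)⁻¹ * ∑ w, ∑ b, if g b ≠ w then V (x w) b else 0

/-- The empirical law of the letters of a codebook of block length `n`, averaged over all
codewords and all positions. -/
noncomputable def empLaw {A W : Type*} [Fintype W] [DecidableEq A] {n : ℕ} (x : W → Fin n → A)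
    (a : A) : ℝ :=
  ((Fintype.card W : ℝ) * n)⁻¹ * ∑ w, ∑ i, if x w i = a then 1 else 0

theorem sum_empLaw_mul {A W : Type*} [Fintype A] [Fintype W] [DecidableEq A] {n : ℕ}
    (x : W → Fin n → A) (f : A → ℝ) :
    ∑ a, empLaw x a * f a = ((Fintype.card W : ℝ) * n)⁻¹ * ∑ w, ∑ i, f (x w i) := by
  simp only [empLaw, mul_assoc, ← Finset.mul_sum, Finset.sum_mul]
  congr 1
  rw [Finset.sum_comm]
  refine Finset.sum_congr rfl fun w _ => ?_
  rw [Finset.sum_comm]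
  simp

theorem empLaw_mem {A W : Type*} [Fintype A] [Fintype W] [Nonempty W] [DecidableEq A] {n : ℕ}
    (hn : 0 < n) (x : W → Fin n → A) : empLaw x ∈ stdSimplex ℝ A := by
  refine ⟨fun a => mul_nonneg (by positivity) (Finset.sum_nonneg fun w _ =>
    Finset.sum_nonneg fun i _ => by split_ifs <;> norm_num), ?_⟩
  have h := sum_empLaw_mul x fun _ => 1
  have hW : (Fintype.card W : ℝ) ≠ 0 := by simp
  have hn' : (n : ℝ) ≠ 0 := by positivity
  simp only [mul_one] at h
  rw [h]
  simp
  field_simp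

theorem empLaw_pos {A W : Type*} [Fintype W] [DecidableEq A] {n : ℕ} (x : W → Fin n → A) (w : W)
    (i : Fin n) : 0 < empLaw x (x w i) := by
  have hW : 0 < Fintype.card W := Fintype.card_pos_iff.2 ⟨w⟩
  have hn : 0 < n := i.pos
  have h0 : ∀ w' (i' : Fin n), (0 : ℝ) ≤ if x w' i' = x w i then 1 else 0 := fun w' i' => by
    split_ifs <;> norm_num
  refine mul_pos (by positivity) (Finset.sum_pos'
    (fun w' _ => Finset.sum_nonneg fun i' _ => h0 w' i')
    ⟨w, Finset.mem_univ w, Finset.sum_pos' (fun i' _ => h0 w i') ⟨i, Finset.mem_univ i, by simp⟩⟩)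

end Block

/-! ### Converse for a memoryless channel -/

section Converse

/-- The pointwise inequality behind the Donsker–Varadhan bound, for a likelihood `p = ∏ u`, an
auxiliary law `q = ∏ v` and a weight `c`. -/
theorem prod_mul_log_le {ι : Type*} [Fintype ι] {u v : ι → ℝ} (hu : ∀ i, 0 ≤ u i)
    (hv : ∀ i, 0 ≤ v i) (huv : ∀ i, 0 < u i → 0 < v i) {c : ℝ} (hc : 0 < c) :
    (∏ i, u i) * (Real.log c - (∑ i, (Real.log (u i) - Real.log (v i))) - Real.log 2) ≤
      (∏ i, v i) * c / 2 - ∏ i, u i := by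
  have hv0 : 0 ≤ (∏ i, v i) * c / 2 := by
    have := Finset.prod_nonneg fun i (_ : i ∈ Finset.univ) => hv i
    positivity
  by_cases h : ∀ i, 0 < u i
  · have hp : 0 < ∏ i, u i := Finset.prod_pos fun i _ => h i
    have hq : 0 < ∏ i, v i := Finset.prod_pos fun i _ => huv i (h i)
    have hlog := Real.log_le_sub_one_of_pos
      (show 0 < (∏ i, v i) * c / 2 / ∏ i, u i by positivity)
    rw [Real.log_div (by positivity) hp.ne', Real.log_div (by positivity) two_ne_zero,
      Real.log_mul hq.ne' hc.ne', Real.log_prod fun i _ => (huv i (h i)).ne',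
      Real.log_prod fun i _ => (h i).ne'] at hlog
    have h1 := mul_le_mul_of_nonneg_left hlog hp.le
    rw [mul_sub _ (_ / _), mul_div_cancel₀ _ hp.ne', mul_one] at h1
    rw [Finset.sum_sub_distrib]
    refine le_trans (le_of_eq ?_) h1
    ring
  · push Not at h
    obtain ⟨i, hi⟩ := h
    have : ∏ i, u i = 0 := Finset.prod_eq_zero (Finset.mem_univ i) (le_antisymm hi (hu i))
    rw [this]
    simpa using hv0

/-- Strong form of Fano's inequality for a memoryless channel. The joint law of message and output
is compared with the law under which the output is i.i.d. with the output law of the empirical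
input law, independently of the message: there every decoder is correct with probability `1 / |W|`,
and the divergence of the two laws is exactly `n I(P, V)`. -/
theorem one_sub_avgError_mul_log_card_le {A B W : Type*} [Fintype A] [Fintype B] [Fintype W]
    [DecidableEq W] [Nonempty W] [DecidableEq A] {V : A → B → ℝ} (hV : ∀ a, V a ∈ stdSimplex ℝ B)
    {n : ℕ} (hn : 0 < n) (x : W → Fin n → A) (g : (Fin n → B) → W) :
    (1 - avgError (blockChannel V n) x g) * Real.logb 2 (Fintype.card W) ≤
      n * info (empLaw x) V + 1 := by
  set M : ℝ := (Fintype.card W : ℝ) with hM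
  have hM1 : 1 ≤ M := by
    rw [hM]; exact_mod_cast Fintype.card_pos
  have hM0 : 0 < M := by linarith
  set Q := outLaw (empLaw x) V with hQ
  have hE := empLaw_mem hn x
  have hVn : ∀ a b, 0 ≤ V a b := fun a b => (hV a).1 b
  have hQ0 : ∀ b, 0 ≤ Q b := outLaw_nonneg hE.1 hVn
  have hQ1 : ∑ b, Q b = 1 := sum_outLaw hE.2 fun a => (hV a).2
  have hsum : ∀ w, ∑ b, blockChannel V n (x w) b = 1 := fun w => (blockChannel_mem hV n (x w)).2
  have hQn : ∑ b : Fin n → B, ∏ i, Q (b i) = 1 := by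
    rw [sum_pi_prod fun _ => Q]; simp [hQ1]
  -- `φ` is the information density; its values at zero likelihoods carry weight zero.
  let φ : A → B → ℝ := fun a b => Real.log (V a b) - Real.log (Q b)
  -- Donsker–Varadhan with test function `log M` on correct decoding; the weight has expectation at
  -- most `2` under the product law, which is where the `log 2` comes from.
  have hpt : ∀ w (b : Fin n → B), blockChannel V n (x w) b *
      (Real.log (if g b = w then M else 1) - (∑ i, φ (x w i) (b i)) - Real.log 2) ≤
      (∏ i, Q (b i)) * ((if g b = w then M else 0) + 1) / 2 - blockChannel V n (x w) b := by
    intro w b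
    refine (prod_mul_log_le (fun i => hVn _ _) (fun i => hQ0 (b i))
      (fun i hi => outLaw_pos hE.1 hVn (empLaw_pos x w i) hi)
      (c := if g b = w then M else 1) (by split_ifs <;> positivity)).trans ?_
    have := Finset.prod_nonneg fun i (_ : i ∈ Finset.univ) => hQ0 (b i)
    unfold blockChannel
    gcongr
    split_ifs <;> linarith
  have hdiv : ∑ w, ∑ b, blockChannel V n (x w) b * ∑ i, φ (x w i) (b i) =
      M * (n * (info (empLaw x) V * Real.log 2)) := by
    have h1 : ∀ w, ∑ b, blockChannel V n (x w) b * ∑ i, φ (x w i) (b i) =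
        ∑ i, ∑ b, V (x w i) b * φ (x w i) b := by
      intro w
      simp only [Finset.mul_sum]
      rw [Finset.sum_comm]
      exact Finset.sum_congr rfl fun i _ => sum_pi_prod_mul_coord_of_sum_eq_one
        (fun j => V (x w j)) (fun j => (hV _).2) i (φ (x w i))
    rw [Finset.sum_congr rfl fun w _ => h1 w, info_mul_log_two]
    have h2 := sum_empLaw_mul x fun a => ∑ b, V a b * φ a b
    simp only [Finset.mul_sum, ← mul_assoc] at h2 ⊢
    simp only [← Finset.mul_sum, mul_assoc] at h2 ⊢
    rw [h2]
    have hn' : (n : ℝ) ≠ 0 := by positivity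
    field_simp
    rfl
  have hlog : ∑ w, ∑ b, blockChannel V n (x w) b * Real.log (if g b = w then M else 1) =
      M * ((1 - avgError (blockChannel V n) x g) * Real.log M) := by
    have h1 : ∀ w, ∑ b, blockChannel V n (x w) b * Real.log (if g b = w then M else 1) =
        (1 - ∑ b, if g b ≠ w then blockChannel V n (x w) b else 0) * Real.log M := by
      intro w
      trans (∑ b, blockChannel V n (x w) b -
        ∑ b, if g b ≠ w then blockChannel V n (x w) b else 0) * Real.log M
      swap
      · rw [hsum w]
      rw [← Finset.sum_sub_distrib, Finset.sum_mul]
      refine Finset.sum_congr rfl fun b _ => ?_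
      by_cases h : g b = w <;> simp [h]
    rw [Finset.sum_congr rfl fun w _ => h1 w, ← Finset.sum_mul, Finset.sum_sub_distrib, avgError,
      ← hM, ← mul_assoc, mul_sub, mul_inv_cancel_left₀ hM0.ne']
    simp [hM]
  have hq : ∑ w, ∑ b : Fin n → B,
      ((∏ i, Q (b i)) * ((if g b = w then M else 0) + 1) / 2 - blockChannel V n (x w) b) = 0 := by
    simp only [Finset.sum_sub_distrib, hsum]
    rw [Finset.sum_comm]
    have h1 : ∀ b : Fin n → B, ∑ w, (∏ i, Q (b i)) * ((if g b = w then M else 0) + 1) / 2 =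
        (∏ i, Q (b i)) * M := by
      intro b
      rw [← Finset.sum_div, ← Finset.mul_sum, Finset.sum_add_distrib]
      simp
      ring
    rw [Finset.sum_congr rfl fun b _ => h1 b, ← Finset.sum_mul, hQn]
    simp [hM]
  have htot := Finset.sum_le_sum fun w (_ : w ∈ Finset.univ) =>
    Finset.sum_le_sum fun b (_ : b ∈ Finset.univ) => hpt w b
  simp only [mul_sub] at htot
  rw [hq] at htot
  simp only [Finset.sum_sub_distrib, ← Finset.sum_mul, hsum] at htot
  rw [hlog, hdiv] at htot
  have hl2 : 0 < Real.log 2 := Real.log_pos one_lt_two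
  rw [Real.logb, ← mul_div_assoc, div_le_iff₀ hl2]
  have h3 : M * ((1 - avgError (blockChannel V n) x g) * Real.log M -
      n * (info (empLaw x) V * Real.log 2) - Real.log 2) ≤ 0 := by
    refine le_trans (le_of_eq ?_) htot
    simp [hM]
    ring
  have := nonpos_of_mul_nonpos_right h3 hM0
  linarith

end Converse

/-! ### Random coding -/

section RandomCoding

/-- The maximum likelihood decoder of the codebook `x` on the channel `V`. -/
noncomputable def mlDecoder {A B W : Type*} [Finite W] [Nonempty W] (V : A → B → ℝ) (x : W → A)
    (b : B) : W :=
  Classical.choose (Finite.exists_max fun w => V (x w) b)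

theorem le_mlDecoder {A B W : Type*} [Finite W] [Nonempty W] (V : A → B → ℝ) (x : W → A) (b : B)
    (w : W) : V (x w) b ≤ V (x (mlDecoder V x b)) b :=
  Classical.choose_spec (Finite.exists_max fun w => V (x w) b) w

/-- One-shot random coding bound. If maximum likelihood decoding fails, then either the likelihood
of the sent word is at most `θ` times the output probability, or a word that is independent of the
output exceeds this threshold; the second event has probability at most `θ⁻¹` for each word. -/
theorem sum_avgError_mlDecoder_le {A B W : Type*} [Fintype A] [Fintype B] [Fintype W]
    [DecidableEq W] [Nonempty W] {P : A → ℝ} (hP : P ∈ stdSimplex ℝ A) {V : A → B → ℝ}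
    (hV : ∀ a, V a ∈ stdSimplex ℝ B) {θ : ℝ} (hθ : 0 < θ) :
    ∑ x : W → A, (∏ w, P (x w)) * avgError V x (mlDecoder V x) ≤
      (∑ a, ∑ b, if V a b ≤ θ * outLaw P V b then P a * V a b else 0) +
        Fintype.card W * θ⁻¹ := by
  classical
  set Q := outLaw P V with hQ
  have hW : (0 : ℝ) < Fintype.card W := by exact_mod_cast Fintype.card_pos
  have hprod : ∀ x : W → A, 0 ≤ ∏ w, P (x w) := fun x => Finset.prod_nonneg fun w _ => hP.1 _
  have hVn : ∀ a b, 0 ≤ V a b := fun a b => (hV a).1 b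
  let low : A → B → ℝ := fun a b => if V a b ≤ θ * Q b then 1 else 0
  let high : A → B → ℝ := fun a b => if θ * Q b < V a b then 1 else 0
  have hlow : ∀ a b, 0 ≤ low a b := fun a b => by dsimp only [low]; split_ifs <;> norm_num
  have hhigh : ∀ a b, 0 ≤ high a b := fun a b => by dsimp only [high]; split_ifs <;> norm_num
  have hpt : ∀ (x : W → A) w b, (if mlDecoder V x b ≠ w then V (x w) b else 0) ≤
      V (x w) b * low (x w) b + ∑ w' ∈ Finset.univ.erase w, V (x w) b * high (x w') b := by
    intro x w b
    have h2 : ∀ w', 0 ≤ V (x w) b * high (x w') b := fun w' => mul_nonneg (hVn _ _) (hhigh _ _)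
    have h1 : 0 ≤ V (x w) b * low (x w) b := mul_nonneg (hVn _ _) (hlow _ _)
    have h3 := Finset.sum_nonneg fun w' (_ : w' ∈ Finset.univ.erase w) => h2 w'
    split_ifs with hne
    · by_cases hl : V (x w) b ≤ θ * Q b
      · have : low (x w) b = 1 := if_pos hl
        rw [this, mul_one]
        linarith
      · have hh : high (x (mlDecoder V x b)) b = 1 :=
          if_pos ((not_le.1 hl).trans_le (le_mlDecoder V x b w))
        have := Finset.single_le_sum (f := fun w' => V (x w) b * high (x w') b)
          (fun w' _ => h2 w') (Finset.mem_erase.2 ⟨hne, Finset.mem_univ (mlDecoder V x b)⟩)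
        simp only [hh, mul_one] at this
        linarith
    · linarith
  have hlowE : ∀ w, ∑ x : W → A, (∏ w, P (x w)) * ∑ b, V (x w) b * low (x w) b =
      ∑ a, ∑ b, if V a b ≤ θ * Q b then P a * V a b else 0 := by
    intro w
    rw [sum_pi_prod_mul_coord_of_sum_eq_one (fun _ : W => P) (fun _ => hP.2) w
      fun a => ∑ b, V a b * low a b]
    refine Finset.sum_congr rfl fun a _ => ?_
    rw [Finset.mul_sum]
    refine Finset.sum_congr rfl fun b _ => ?_
    dsimp only [low]
    split_ifs <;> simp
  have hhighE : ∀ w w', w' ≠ w →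
      ∑ x : W → A, (∏ w, P (x w)) * ∑ b, V (x w) b * high (x w') b ≤ θ⁻¹ := by
    intro w w' hne
    simp only [Finset.mul_sum]
    rw [Finset.sum_comm]
    have h1 : ∀ b, ∑ x : W → A, (∏ w, P (x w)) * (V (x w) b * high (x w') b) ≤ θ⁻¹ * Q b := by
      intro b
      rw [sum_pi_prod_mul_two_coords P hP.2 hne.symm (fun a => V a b) (fun a => high a b)]
      change Q b * _ ≤ _
      rw [Finset.mul_sum, hQ, outLaw, Finset.mul_sum]
      refine Finset.sum_le_sum fun a _ => ?_
      change Q b * _ ≤ _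
      rw [mul_left_comm, mul_left_comm θ⁻¹]
      refine mul_le_mul_of_nonneg_left ?_ (hP.1 a)
      dsimp only [high]
      split_ifs with h
      · rw [mul_one, inv_mul_eq_div, le_div_iff₀ hθ, mul_comm]
        exact h.le
      · rw [mul_zero]
        exact mul_nonneg (inv_nonneg.2 hθ.le) (hVn a b)
    refine (Finset.sum_le_sum fun b _ => h1 b).trans_eq ?_
    rw [← Finset.mul_sum, sum_outLaw hP.2 fun a => (hV a).2, mul_one]
  set L := ∑ a, ∑ b, if V a b ≤ θ * Q b then P a * V a b else 0
  have hw : ∀ w, ∑ x : W → A, (∏ w, P (x w)) *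
      ∑ b, (if mlDecoder V x b ≠ w then V (x w) b else 0) ≤ L + Fintype.card W * θ⁻¹ := by
    intro w
    have h1 : ∑ x : W → A, (∏ w, P (x w)) *
        ∑ b, (if mlDecoder V x b ≠ w then V (x w) b else 0) ≤
        ∑ x : W → A, (∏ w, P (x w)) * ∑ b, (V (x w) b * low (x w) b +
          ∑ w' ∈ Finset.univ.erase w, V (x w) b * high (x w') b) :=
      Finset.sum_le_sum fun x _ => mul_le_mul_of_nonneg_left
        (Finset.sum_le_sum fun b _ => hpt x w b) (hprod x)
    refine h1.trans ?_
    simp only [Finset.sum_add_distrib, mul_add]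
    rw [hlowE w]
    gcongr
    have h2 : ∀ x : W → A, (∏ w, P (x w)) *
        ∑ b, ∑ w' ∈ Finset.univ.erase w, V (x w) b * high (x w') b =
        ∑ w' ∈ Finset.univ.erase w, (∏ w, P (x w)) * ∑ b, V (x w) b * high (x w') b := by
      intro x
      rw [Finset.sum_comm, Finset.mul_sum]
    rw [Finset.sum_congr rfl fun x _ => h2 x, Finset.sum_comm]
    refine (Finset.sum_le_sum fun w' hw' => hhighE w w' (Finset.ne_of_mem_erase hw')).trans ?_
    rw [Finset.sum_const, nsmul_eq_mul]
    gcongr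
    exact Finset.card_le_univ _
  have hswap : ∑ x : W → A, (∏ w, P (x w)) * avgError V x (mlDecoder V x) =
      (Fintype.card W : ℝ)⁻¹ * ∑ w, ∑ x : W → A, (∏ w, P (x w)) *
        ∑ b, (if mlDecoder V x b ≠ w then V (x w) b else 0) := by
    rw [Finset.sum_comm, Finset.mul_sum]
    refine Finset.sum_congr rfl fun x _ => ?_
    rw [avgError, ← Finset.mul_sum, mul_left_comm]
  rw [hswap, inv_mul_le_iff₀ hW]
  refine (Finset.sum_le_sum fun w _ => hw w).trans_eq ?_
  rw [Finset.sum_const, Finset.card_univ, nsmul_eq_mul]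

/-- A Chernoff exponent: if the mean of `g` is negative, some exponential moment is below `1`. -/
theorem exists_exp_moment_lt_one {ι : Type*} [Fintype ι] (p g : ι → ℝ) (hp : ∑ i, p i = 1)
    (hg : ∑ i, p i * g i < 0) : ∃ t : ℝ, 0 < t ∧ ∑ i, p i * Real.exp (t * g i) < 1 := by
  have hd : HasDerivAt (fun t : ℝ => ∑ i, p i * Real.exp (t * g i)) (∑ i, p i * g i) 0 := by
    refine HasDerivAt.fun_sum fun i _ => ?_
    have h := (((hasDerivAt_id (0 : ℝ)).mul_const (g i)).exp).const_mul (p i)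
    simpa using h
  have hsub : Set.Ioi (0 : ℝ) ⊆ {0}ᶜ := fun t ht => (Set.mem_Ioi.1 ht).ne'
  have hslope := (hasDerivAt_iff_tendsto_slope.1 hd).mono_left (nhdsWithin_mono 0 hsub)
  obtain ⟨t, hneg, ht⟩ := ((hslope.eventually_lt_const hg).and self_mem_nhdsWithin).exists
  have ht0 : 0 < t := ht
  refine ⟨t, ht0, ?_⟩
  rw [slope_def_field, sub_zero, div_lt_iff₀ ht0, zero_mul] at hneg
  simpa [hp] using hneg

/-- Chernoff bound for the event that a block likelihood is at most `θⁿ` times the output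
probability. -/
theorem sum_blockChannel_le_pow {A B : Type*} [Fintype A] [Fintype B] {P : A → ℝ}
    (hP : ∀ a, 0 ≤ P a) {V : A → B → ℝ} (hV : ∀ a b, 0 ≤ V a b) {θ t : ℝ} (hθ : 0 < θ)
    (ht : 0 < t) (n : ℕ) :
    (∑ x : Fin n → A, ∑ b : Fin n → B,
      if blockChannel V n x b ≤ θ ^ n * outLaw (fun x => ∏ i, P (x i)) (blockChannel V n) b
        then (∏ i, P (x i)) * blockChannel V n x b else 0) ≤
    (∑ a, ∑ b, P a * V a b *
      Real.exp (t * (Real.log θ + Real.log (outLaw P V b) - Real.log (V a b)))) ^ n := by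
  set Q := outLaw P V with hQ
  let k : A → B → ℝ := fun a b => P a * V a b *
    Real.exp (t * (Real.log θ + Real.log (Q b) - Real.log (V a b)))
  have hk : ∀ a b, 0 ≤ k a b := fun a b =>
    mul_nonneg (mul_nonneg (hP a) (hV a b)) (Real.exp_nonneg _)
  have hout : ∀ b : Fin n → B,
      outLaw (fun x => ∏ i, P (x i)) (blockChannel V n) b = ∏ i, Q (b i) := by
    intro b
    simp only [outLaw, blockChannel, ← Finset.prod_mul_distrib]
    rw [sum_pi_prod fun i a => P a * V a (b i)]
    rfl
  have hpow : (∑ a, ∑ b, k a b) ^ n = ∑ x : Fin n → A, ∑ b : Fin n → B, ∏ i, k (x i) (b i) := by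
    rw [← Fin.prod_const, ← sum_pi_prod]
    exact Finset.sum_congr rfl fun x _ => (sum_pi_prod fun i => k (x i)).symm
  change _ ≤ (∑ a, ∑ b, k a b) ^ n
  rw [hpow]
  refine Finset.sum_le_sum fun x _ => Finset.sum_le_sum fun b _ => ?_
  have hk0 : 0 ≤ ∏ i, k (x i) (b i) := Finset.prod_nonneg fun i _ => hk _ _
  rw [hout]
  split_ifs with h
  swap
  · exact hk0
  rw [blockChannel, ← Finset.prod_mul_distrib]
  by_cases hpos : ∀ i, 0 < P (x i) * V (x i) (b i)
  · have hPp : ∀ i, 0 < P (x i) := fun i => pos_of_mul_pos_left (hpos i) (hV _ _)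
    have hVp : ∀ i, 0 < V (x i) (b i) := fun i => pos_of_mul_pos_right (hpos i) (hP _)
    have hQp : ∀ i, 0 < Q (b i) := fun i => outLaw_pos hP hV (hPp i) (hVp i)
    have hlog := Real.log_le_log (Finset.prod_pos fun i _ => hVp i) h
    rw [Real.log_mul (pow_pos hθ n).ne' (Finset.prod_pos fun i _ => hQp i).ne', Real.log_pow,
      Real.log_prod fun i _ => (hQp i).ne', Real.log_prod fun i _ => (hVp i).ne'] at hlog
    rw [Finset.prod_mul_distrib (f := fun i => P (x i) * V (x i) (b i)), ← Real.exp_sum,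
      ← Finset.mul_sum, Finset.sum_sub_distrib, Finset.sum_add_distrib]
    refine le_mul_of_one_le_right (Finset.prod_nonneg fun i _ => (hpos i).le) ?_
    refine Real.one_le_exp (mul_nonneg ht.le ?_)
    simp only [Finset.sum_const, Finset.card_univ, Fintype.card_fin, nsmul_eq_mul]
    linarith
  · push Not at hpos
    obtain ⟨i, hi⟩ := hpos
    rw [Finset.prod_eq_zero (f := fun i => P (x i) * V (x i) (b i)) (Finset.mem_univ i)
      (le_antisymm hi (mul_nonneg (hP _) (hV _ _)))]
    exact hk0

/-- Channel coding theorem in the random coding form: below the mutual information, the error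
probability averaged over i.i.d. codebooks vanishes. At rate zero there is a single message and
nothing to decode. -/
theorem exists_tendsto_sum_avgError_le {A B : Type*} [Fintype A] [Fintype B] {P : A → ℝ}
    (hP : P ∈ stdSimplex ℝ A) {V : A → B → ℝ} (hV : ∀ a, V a ∈ stdSimplex ℝ B) {R : ℝ}
    (hR : 0 ≤ R) (hRI : R = 0 ∨ R < info P V) :
    ∃ ε : ℕ → ℝ, Tendsto ε atTop (𝓝 0) ∧ ∀ (n : ℕ) (W : Type) [Fintype W] [DecidableEq W]
      [Nonempty W], Fintype.card W = numMessages n R →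
      ∑ x : W → Fin n → A, (∏ w, ∏ i, P (x w i)) *
        avgError (blockChannel V n) x (mlDecoder (blockChannel V n) x) ≤ ε n := by
  rcases hRI with rfl | hRI
  · refine ⟨fun _ => 0, tendsto_const_nhds, fun n W _ _ _ hW => ?_⟩
    have : Subsingleton W := by
      rw [← Fintype.card_le_one_iff_subsingleton, hW]
      simp [numMessages]
    refine Finset.sum_nonpos fun x _ => ?_
    simp [avgError, eq_iff_true_of_subsingleton]
  -- The threshold `θ ^ n` with `θ = 2 ^ γ` and `R < γ < I(P, V)` makes both error terms decay
  -- exponentially.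
  obtain ⟨γ, hRγ, hγI⟩ := exists_between hRI
  have hl2 : 0 < Real.log 2 := Real.log_pos one_lt_two
  set θ : ℝ := 2 ^ γ with hθ
  have hθ0 : 0 < θ := by positivity
  let p : A × B → ℝ := fun c => P c.1 * V c.1 c.2
  let g : A × B → ℝ := fun c =>
    Real.log θ + Real.log (outLaw P V c.2) - Real.log (V c.1 c.2)
  have hp1 : ∑ c, p c = 1 := by
    rw [Fintype.sum_prod_type]
    simp [p, ← Finset.mul_sum, (hV _).2, hP.2]
  have hg : ∑ c, p c * g c < 0 := by
    have h1 : ∑ c, p c * g c = Real.log θ * ∑ c, p c - info P V * Real.log 2 := by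
      rw [info_mul_log_two, ← Fintype.sum_prod_type', Finset.mul_sum, ← Finset.sum_sub_distrib]
      refine Finset.sum_congr rfl fun c _ => ?_
      dsimp only [p, g]
      ring
    rw [h1, hp1, hθ, Real.log_rpow two_pos, mul_one, ← sub_mul]
    exact mul_neg_of_neg_of_pos (by linarith) hl2
  obtain ⟨t, ht, hlt⟩ := exists_exp_moment_lt_one p g hp1 hg
  rw [Fintype.sum_prod_type] at hlt
  set ρ := ∑ a, ∑ b, p (a, b) * Real.exp (t * g (a, b)) with hρ
  have hρ0 : 0 ≤ ρ := Finset.sum_nonneg fun a _ => Finset.sum_nonneg fun b _ =>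
    mul_nonneg (mul_nonneg (hP.1 a) ((hV a).1 b)) (Real.exp_nonneg _)
  set σ : ℝ := 2 ^ R * θ⁻¹ with hσ
  have hσ0 : 0 ≤ σ := by positivity
  have hσ1 : σ < 1 := by
    rw [hσ, ← div_eq_mul_inv, div_lt_one hθ0]
    exact Real.rpow_lt_rpow_of_exponent_lt one_lt_two hRγ
  refine ⟨fun n => ρ ^ n + 2 * σ ^ n, ?_, fun n W _ _ _ hW => ?_⟩
  · simpa using (tendsto_pow_atTop_nhds_zero_of_lt_one hρ0 hlt).add
      ((tendsto_pow_atTop_nhds_zero_of_lt_one hσ0 hσ1).const_mul 2)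
  have hPn : (fun x : Fin n → A => ∏ i, P (x i)) ∈ stdSimplex ℝ (Fin n → A) :=
    ⟨fun x => Finset.prod_nonneg fun i _ => hP.1 _, by
      rw [sum_pi_prod fun _ : Fin n => P]; simp [hP.2]⟩
  refine (sum_avgError_mlDecoder_le hPn (blockChannel_mem hV n) (pow_pos hθ0 n)).trans ?_
  refine add_le_add (sum_blockChannel_le_pow hP.1 (fun a b => (hV a).1 b) hθ0 ht n) ?_
  have hM : (Fintype.card W : ℝ) ≤ 2 * (2 ^ R) ^ n := by
    have h1 : (2 : ℝ) ^ ((n : ℝ) * R) = (2 ^ R) ^ n := by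
      rw [mul_comm, Real.rpow_mul_natCast zero_le_two]
    have h2 : (1 : ℝ) ≤ (2 ^ R) ^ n := one_le_pow₀ (Real.one_le_rpow one_le_two hR)
    rw [hW, numMessages, h1]
    have := Nat.ceil_lt_add_one (show (0 : ℝ) ≤ (2 ^ R) ^ n by positivity)
    linarith
  rw [hσ, mul_pow, inv_pow, ← mul_assoc]
  gcongr

end RandomCoding

/-! ### The two point-to-point channels -/

section Channels

variable {X S Y Z : Type*} [Fintype X] [Fintype S] [Fintype Y] [Fintype Z] (ch : Channel X S Y Z)

/-- The channel from the input to the observation `(y, s)` of the communication receiver. -/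
def commChannel (x : X) (c : Y × S) : ℝ := ch.stateLaw c.2 * ∑ z, ch.trans x c.2 (c.1, z)

/-- The channel from the input to the observation `z` of the sensing receiver. -/
def sensChannel (x : X) (z : Z) : ℝ := ∑ s, ch.stateLaw s * transZ ch x s z

theorem transZ_nonneg (x : X) (s : S) (z : Z) : 0 ≤ transZ ch x s z :=
  Finset.sum_nonneg fun _ _ => (ch.trans_mem x s).1 _

theorem stateLaw_mul_transZ_nonneg (x : X) (s : S) (z : Z) :
    0 ≤ ch.stateLaw s * transZ ch x s z :=
  mul_nonneg (ch.stateLaw_mem.1 s) (transZ_nonneg ch x s z)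

theorem commChannel_mem (x : X) : commChannel ch x ∈ stdSimplex ℝ (Y × S) := by
  refine ⟨fun c => mul_nonneg (ch.stateLaw_mem.1 _)
    (Finset.sum_nonneg fun z _ => (ch.trans_mem x _).1 _), ?_⟩
  simp only [commChannel]
  rw [Fintype.sum_prod_type_right]
  simp only [← Finset.mul_sum, ← Fintype.sum_prod_type', Prod.mk.eta, (ch.trans_mem x _).2, mul_one,
    ch.stateLaw_mem.2]

theorem sensChannel_mem (x : X) : sensChannel ch x ∈ stdSimplex ℝ Z := by
  refine ⟨fun z => Finset.sum_nonneg fun s _ => stateLaw_mul_transZ_nonneg ch x s z, ?_⟩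
  simp only [sensChannel, transZ]
  rw [Finset.sum_comm]
  simp only [← Finset.mul_sum, ← Fintype.sum_prod_type_right', Prod.mk.eta, (ch.trans_mem x _).2,
    mul_one, ch.stateLaw_mem.2]

theorem infoXYgivenS_eq_info {P : X → ℝ} (hP : P ∈ stdSimplex ℝ X) :
    infoXYgivenS ch P = info P (commChannel ch) := by
  rw [← condMutualInfo_eq_info (r := ch.stateLaw) hP fun x => (commChannel_mem ch x).1]
  · simp only [infoXYgivenS, joint, commChannel, Finset.mul_sum, mul_assoc]
  · intro x s
    simp only [commChannel, ← Finset.mul_sum, ← Fintype.sum_prod_type', Prod.mk.eta,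
      (ch.trans_mem x _).2, mul_one]

theorem infoXZ_eq_info {P : X → ℝ} (hP : P ∈ stdSimplex ℝ X) :
    infoXZ ch P = info P (sensChannel ch) := by
  rw [← mutualInfo_eq_info hP.1 (sensChannel_mem ch)]
  simp only [infoXZ, joint, sensChannel, transZ, Finset.mul_sum, mul_assoc]

theorem sum_mul_transZ_optEstimator_le {T : Type*} [Finite T] [Nonempty T] (d : S → T → ℝ) (x : X)
    (z : Z) (t : T) :
    ∑ s, ch.stateLaw s * transZ ch x s z * d s (optEstimator ch d x z) ≤
      ∑ s, ch.stateLaw s * transZ ch x s z * d s t := by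
  have hnn := stateLaw_mul_transZ_nonneg ch x
  set N := ∑ s, ch.stateLaw s * transZ ch x s z with hN
  have hN0 : 0 ≤ N := Finset.sum_nonneg fun s _ => hnn s z
  -- If `z` has probability zero under `x`, the posterior is `0` by junk, but all terms vanish.
  rcases hN0.eq_or_lt with h0 | hpos
  · have hz := (Finset.sum_eq_zero_iff_of_nonneg fun s _ => hnn s z).1 h0.symm
    refine le_of_eq (Finset.sum_congr rfl fun s hs => ?_)
    rw [hz s hs, zero_mul, zero_mul]
  · have h := mul_le_mul_of_nonneg_left (optEstimator_spec ch d x z t) hpos.le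
    simp only [posterior, ← hN, Finset.mul_sum] at h
    have hr : ∀ t s, N * (ch.stateLaw s * transZ ch x s z / N * d s t) =
        ch.stateLaw s * transZ ch x s z * d s t := fun t s => by
      field_simp
    simpa only [hr] using h

end Channels

/-! ### Error probability and distortion of a code -/

section Codes

variable {X S Y Z : Type*} [Fintype X] [Fintype S] [Fintype Y] [Fintype Z] (ch : Channel X S Y Z)

/-- The block law of state and outputs given the codeword. -/
def blockTrans {n : ℕ} (x : Fin n → X) (s : Fin n → S) (y : Fin n → Y) (z : Fin n → Z) : ℝ :=
  ∏ i, ch.stateLaw (s i) * ch.trans (x i) (s i) (y i, z i)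

variable {n : ℕ} (x : Fin n → X)

theorem blockTrans_nonneg (s : Fin n → S) (y : Fin n → Y) (z : Fin n → Z) :
    0 ≤ blockTrans ch x s y z :=
  Finset.prod_nonneg fun _ _ => mul_nonneg (ch.stateLaw_mem.1 _) ((ch.trans_mem _ _).1 _)

theorem sum_blockTrans_comm (s : Fin n → S) (y : Fin n → Y) :
    ∑ z, blockTrans ch x s y z =
      blockChannel (commChannel ch) n x (fun i => (y i, s i)) := by
  simp only [blockTrans]
  rw [sum_pi_prod fun i z => ch.stateLaw (s i) * ch.trans (x i) (s i) (y i, z)]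
  simp only [← Finset.mul_sum, blockChannel, commChannel]

theorem sum_blockTrans_output (s : Fin n → S) (z : Fin n → Z) :
    ∑ y, blockTrans ch x s y z = ∏ i, ch.stateLaw (s i) * transZ ch (x i) (s i) (z i) := by
  simp only [blockTrans]
  rw [sum_pi_prod fun i y => ch.stateLaw (s i) * ch.trans (x i) (s i) (y, z i)]
  simp only [← Finset.mul_sum, transZ]

theorem sum_blockTrans_sens (z : Fin n → Z) :
    ∑ s, ∑ y, blockTrans ch x s y z = blockChannel (sensChannel ch) n x z := by
  simp only [sum_blockTrans_output]
  rw [sum_pi_prod fun i s => ch.stateLaw s * transZ ch (x i) s (z i)]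
  rfl

/-- Given the codeword, the letters are independent over time, so the `i`-th state depends on the
sensing output only through its `i`-th letter. -/
theorem sum_blockTrans_mul_dist {T : Type*} (d : S → T → ℝ) (i : Fin n) (τ : (Fin n → Z) → T) :
    ∑ s, ∑ y, ∑ z, blockTrans ch x s y z * d (s i) (τ z) =
      ∑ z, (∏ j ∈ Finset.univ.erase i, sensChannel ch (x j) (z j)) *
        ∑ s, ch.stateLaw s * transZ ch (x i) s (z i) * d s (τ z) := by
  have h1 : ∀ s : Fin n → S, ∑ y, ∑ z, blockTrans ch x s y z * d (s i) (τ z) =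
      ∑ z, (∏ j, ch.stateLaw (s j) * transZ ch (x j) (s j) (z j)) * d (s i) (τ z) := by
    intro s
    rw [Finset.sum_comm]
    simp only [← Finset.sum_mul, sum_blockTrans_output]
  rw [Finset.sum_congr rfl fun s _ => h1 s, Finset.sum_comm]
  refine Finset.sum_congr rfl fun z _ => ?_
  exact sum_pi_prod_mul_coord (fun j s => ch.stateLaw s * transZ ch (x j) s (z j)) i
    fun s => d s (τ z)

theorem sum_prod_erase_sensChannel_mul (i : Fin n) (m : Z → ℝ) :
    ∑ z : Fin n → Z, (∏ j ∈ Finset.univ.erase i, sensChannel ch (x j) (z j)) * m (z i) =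
      ∑ z, m z := by
  have h := sum_pi_prod_mul_coord (B := Z) (fun j z => if j = i then 1 else sensChannel ch (x j) z)
    i m
  have h1 : ∀ z : Fin n → Z, (∏ j, if j = i then 1 else sensChannel ch (x j) (z j)) =
      ∏ j ∈ Finset.univ.erase i, sensChannel ch (x j) (z j) := by
    intro z
    rw [← Finset.mul_prod_erase _ _ (Finset.mem_univ i), if_pos rfl, one_mul]
    exact Finset.prod_congr rfl fun j hj => if_neg (Finset.ne_of_mem_erase hj)
  simp only [h1] at h
  rw [h, Finset.prod_eq_one, one_mul]
  · simp
  · intro j hj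
    simp [Finset.ne_of_mem_erase hj, (sensChannel_mem ch _).2]

theorem sum_blockTrans_mul_dist_optEstimator {T : Type*} [Finite T] [Nonempty T] (d : S → T → ℝ)
    (i : Fin n) :
    ∑ s, ∑ y, ∑ z, blockTrans ch x s y z * d (s i) (optEstimator ch d (x i) (z i)) =
      cost ch d (x i) := by
  rw [sum_blockTrans_mul_dist ch x d i fun z => optEstimator ch d (x i) (z i),
    sum_prod_erase_sensChannel_mul ch x i
      fun z => ∑ s, ch.stateLaw s * transZ ch (x i) s z * d s (optEstimator ch d (x i) z),
    Finset.sum_comm, cost]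

theorem cost_le_sum_blockTrans_mul_dist {T : Type*} [Finite T] [Nonempty T] (d : S → T → ℝ)
    (i : Fin n) (τ : (Fin n → Z) → T) :
    cost ch d (x i) ≤ ∑ s, ∑ y, ∑ z, blockTrans ch x s y z * d (s i) (τ z) := by
  rw [← sum_blockTrans_mul_dist_optEstimator, sum_blockTrans_mul_dist ch x d i τ,
    sum_blockTrans_mul_dist ch x d i fun z => optEstimator ch d (x i) (z i)]
  exact Finset.sum_le_sum fun z _ => mul_le_mul_of_nonneg_left
    (sum_mul_transZ_optEstimator_le ch d (x i) (z i) (τ z))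
    (Finset.prod_nonneg fun j _ => (sensChannel_mem ch _).1 _)

theorem sum_blockTrans : ∑ s, ∑ y, ∑ z, blockTrans ch x s y z = 1 := by
  have h : ∀ s : Fin n → S, ∑ y, ∑ z, blockTrans ch x s y z = ∑ z, ∑ y, blockTrans ch x s y z :=
    fun s => Finset.sum_comm
  rw [Finset.sum_congr rfl fun s _ => h s, Finset.sum_comm]
  simp only [sum_blockTrans_sens]
  exact (blockChannel_mem (sensChannel_mem ch) n x).2

variable {T : Type*} {M₀ M₁ : ℕ} (c : Code X S Y Z T M₀ M₁ n)

theorem Code.law_eq (w : Fin M₀ × Fin M₁) (s : Fin n → S) (y : Fin n → Y) (z : Fin n → Z) :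
    c.law ch w s y z =
      (Fintype.card (Fin M₀ × Fin M₁) : ℝ)⁻¹ * blockTrans ch (c.enc w) s y z := by
  simp [Code.law, blockTrans]

theorem Code.law_nonneg (w : Fin M₀ × Fin M₁) (s : Fin n → S) (y : Fin n → Y) (z : Fin n → Z) :
    0 ≤ c.law ch w s y z := by
  rw [c.law_eq]
  exact mul_nonneg (by positivity) (blockTrans_nonneg ch _ s y z)

theorem Code.avgError_commChannel :
    avgError (blockChannel (commChannel ch) n) c.enc
        (fun b => c.dec₁ (fun i => (b i).1) fun i => (b i).2) =
      ∑ w, ∑ s, ∑ y, ∑ z, if c.dec₁ y s ≠ w then c.law ch w s y z else 0 := by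
  rw [avgError, Finset.mul_sum]
  refine Finset.sum_congr rfl fun w _ => ?_
  rw [← (Equiv.arrowProdEquivProdArrow (Fin n) (fun _ => Y) (fun _ => S)).symm.sum_comp,
    Fintype.sum_prod_type_right, Finset.mul_sum]
  refine Finset.sum_congr rfl fun s _ => ?_
  rw [Finset.mul_sum]
  refine Finset.sum_congr rfl fun y _ => ?_
  change _ * (if c.dec₁ y s ≠ w then
    blockChannel (commChannel ch) n (c.enc w) (fun i => (y i, s i)) else 0) = _
  rw [← sum_blockTrans_comm]
  split_ifs
  · simp only [c.law_eq, Finset.mul_sum]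
  · simp

theorem Code.avgError_sensChannel (g : (Fin n → Z) → Fin M₀ × Fin M₁)
    (hg : ∀ z w, g z ≠ w ↔ c.dec₂ z ≠ w.1) :
    avgError (blockChannel (sensChannel ch) n) c.enc g =
      ∑ w, ∑ s, ∑ y, ∑ z, if c.dec₂ z ≠ w.1 then c.law ch w s y z else 0 := by
  rw [avgError, Finset.mul_sum]
  refine Finset.sum_congr rfl fun w _ => ?_
  have h : ∀ s : Fin n → S, (∑ y, ∑ z, if c.dec₂ z ≠ w.1 then c.law ch w s y z else 0) =
      ∑ z, ∑ y, if c.dec₂ z ≠ w.1 then c.law ch w s y z else 0 := fun s => Finset.sum_comm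
  rw [Finset.sum_congr rfl fun s _ => h s, Finset.sum_comm, Finset.mul_sum]
  refine Finset.sum_congr rfl fun z _ => ?_
  simp only [hg]
  split_ifs
  · simp only [c.law_eq, ← Finset.mul_sum, sum_blockTrans_sens]
  · simp

theorem Code.avgError_commChannel_le_errorProb :
    avgError (blockChannel (commChannel ch) n) c.enc
        (fun b => c.dec₁ (fun i => (b i).1) fun i => (b i).2) ≤ c.errorProb ch := by
  rw [c.avgError_commChannel, Code.errorProb]
  refine Finset.sum_le_sum fun w _ => Finset.sum_le_sum fun s _ => Finset.sum_le_sum fun y _ =>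
    Finset.sum_le_sum fun z _ => ?_
  have := c.law_nonneg ch w s y z
  split_ifs <;> simp_all

theorem Code.avgError_sensChannel_le_errorProb (g : (Fin n → Z) → Fin M₀ × Fin M₁)
    (hg : ∀ z w, g z ≠ w ↔ c.dec₂ z ≠ w.1) :
    avgError (blockChannel (sensChannel ch) n) c.enc g ≤ c.errorProb ch := by
  rw [c.avgError_sensChannel ch g hg, Code.errorProb]
  refine Finset.sum_le_sum fun w _ => Finset.sum_le_sum fun s _ => Finset.sum_le_sum fun y _ =>
    Finset.sum_le_sum fun z _ => ?_
  have := c.law_nonneg ch w s y z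
  split_ifs <;> simp_all

theorem Code.errorProb_le_add (g : (Fin n → Z) → Fin M₀ × Fin M₁)
    (hg : ∀ z w, g z ≠ w ↔ c.dec₂ z ≠ w.1) :
    c.errorProb ch ≤
      avgError (blockChannel (commChannel ch) n) c.enc
        (fun b => c.dec₁ (fun i => (b i).1) fun i => (b i).2) +
      avgError (blockChannel (sensChannel ch) n) c.enc g := by
  rw [c.avgError_commChannel, c.avgError_sensChannel ch g hg, Code.errorProb]
  simp only [← Finset.sum_add_distrib]
  refine Finset.sum_le_sum fun w _ => Finset.sum_le_sum fun s _ => Finset.sum_le_sum fun y _ =>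
    Finset.sum_le_sum fun z _ => ?_
  have := c.law_nonneg ch w s y z
  split_ifs <;> simp_all

theorem Code.errorProb_nonneg : 0 ≤ c.errorProb ch := by
  refine Finset.sum_nonneg fun w _ => Finset.sum_nonneg fun s _ => Finset.sum_nonneg fun y _ =>
    Finset.sum_nonneg fun z _ => ?_
  have := c.law_nonneg ch w s y z
  split_ifs <;> simp_all

theorem Code.distortion_eq (d : S → T → ℝ) :
    c.distortion ch d = ((Fintype.card (Fin M₀ × Fin M₁) : ℝ) * n)⁻¹ * ∑ w, ∑ i,
      ∑ s, ∑ y, ∑ z, blockTrans ch (c.enc w) s y z * d (s i) (c.est z i) := by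
  rw [Code.distortion, mul_inv, mul_comm _ (n : ℝ)⁻¹, mul_assoc]
  simp only [c.law_eq, mul_assoc, ← Finset.mul_sum]
  rw [Finset.sum_comm]

theorem Code.distortion_nonneg {d : S → T → ℝ} (hd : ∀ s t, 0 ≤ d s t) :
    0 ≤ c.distortion ch d := by
  rw [c.distortion_eq]
  exact mul_nonneg (by positivity) (Finset.sum_nonneg fun w _ => Finset.sum_nonneg fun i _ =>
    Finset.sum_nonneg fun s _ => Finset.sum_nonneg fun y _ => Finset.sum_nonneg fun z _ =>
      mul_nonneg (blockTrans_nonneg ch _ s y z) (hd _ _))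

theorem Code.distortion_le {d : S → T → ℝ} {K : ℝ} (hK0 : 0 ≤ K) (hK : ∀ s t, d s t ≤ K) :
    c.distortion ch d ≤ K := by
  rw [c.distortion_eq]
  have h : ∀ w i, ∑ s, ∑ y, ∑ z, blockTrans ch (c.enc w) s y z * d (s i) (c.est z i) ≤ K := by
    intro w i
    rw [← one_mul K, ← sum_blockTrans ch (c.enc w)]
    simp only [Finset.sum_mul]
    exact Finset.sum_le_sum fun s _ => Finset.sum_le_sum fun y _ => Finset.sum_le_sum fun z _ =>
      mul_le_mul_of_nonneg_left (hK _ _) (blockTrans_nonneg ch _ s y z)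
  refine (mul_le_mul_of_nonneg_left (Finset.sum_le_sum fun w _ => Finset.sum_le_sum fun i _ =>
    h w i) (by positivity)).trans ?_
  simp only [Finset.sum_const, Finset.card_univ, Fintype.card_fin (n := n), nsmul_eq_mul,
    ← mul_assoc (_ : ℝ) (n : ℝ) K]
  rw [← mul_assoc]
  exact mul_le_of_le_one_left hK0 inv_mul_le_one

theorem Code.sum_empLaw_mul_cost_le_distortion [Finite T] [Nonempty T] [DecidableEq X]
    (d : S → T → ℝ) : ∑ a, empLaw c.enc a * cost ch d a ≤ c.distortion ch d := by
  rw [c.distortion_eq, sum_empLaw_mul]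
  exact mul_le_mul_of_nonneg_left (Finset.sum_le_sum fun w _ => Finset.sum_le_sum fun i _ =>
    cost_le_sum_blockTrans_mul_dist ch (c.enc w) d i fun z => c.est z i) (by positivity)

/-- The estimator that applies the optimal single-letter estimator to the decoded codeword is
optimal unless the decoder is wrong. -/
theorem Code.distortion_le_of_est_eq [Finite T] [Nonempty T] {d : S → T → ℝ}
    (hd : ∀ s t, 0 ≤ d s t) {K : ℝ} (hK : ∀ s t, d s t ≤ K) (g : (Fin n → Z) → Fin M₀ × Fin M₁)
    (hg : ∀ z w, g z ≠ w ↔ c.dec₂ z ≠ w.1)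
    (hest : ∀ z i, c.est z i = optEstimator ch d (c.enc (g z) i) (z i)) :
    c.distortion ch d ≤ ((Fintype.card (Fin M₀ × Fin M₁) : ℝ) * n)⁻¹ *
      ∑ w, ∑ i, cost ch d (c.enc w i) + K * c.errorProb ch := by
  have hpt : ∀ w i, ∑ s, ∑ y, ∑ z, c.law ch w s y z * d (s i) (c.est z i) ≤
      (Fintype.card (Fin M₀ × Fin M₁) : ℝ)⁻¹ * cost ch d (c.enc w i) +
      K * ∑ s, ∑ y, ∑ z, if c.dec₁ y s ≠ w ∨ c.dec₂ z ≠ w.1 then c.law ch w s y z else 0 := by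
    intro w i
    rw [← sum_blockTrans_mul_dist_optEstimator]
    simp only [Finset.mul_sum, ← Finset.sum_add_distrib]
    refine Finset.sum_le_sum fun s _ => Finset.sum_le_sum fun y _ => Finset.sum_le_sum fun z _ => ?_
    have hl := c.law_nonneg ch w s y z
    rw [← mul_assoc, ← c.law_eq, hest]
    have hK0 : 0 ≤ K := (hd (s i) (c.est z i)).trans (hK _ _)
    by_cases h : g z = w
    · rw [h]
      refine le_add_of_nonneg_right (mul_nonneg hK0 ?_)
      split_ifs
      exacts [hl, le_rfl]
    · rw [if_pos (Or.inr ((hg z w).1 h)), mul_comm K]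
      exact (mul_le_mul_of_nonneg_left (hK _ _) hl).trans
        (le_add_of_nonneg_left (mul_nonneg hl (hd _ _)))
  have hsum := Finset.sum_le_sum fun i (_ : i ∈ Finset.univ) =>
    Finset.sum_le_sum fun w (_ : w ∈ Finset.univ) => hpt w i
  rw [Code.distortion]
  refine (mul_le_mul_of_nonneg_left hsum (by positivity)).trans ?_
  simp only [Finset.sum_add_distrib, ← Finset.mul_sum]
  rw [mul_add]
  refine add_le_add (le_of_eq ?_) ?_
  · rw [Finset.sum_comm, mul_inv, ← mul_assoc, mul_comm (n : ℝ)⁻¹]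
  · change (n : ℝ)⁻¹ * (K * ∑ _i : Fin n, c.errorProb ch) ≤ _
    have hE := c.errorProb_nonneg ch
    rcases Nat.eq_zero_or_pos n with hn | hn
    · subst hn
      rcases isEmpty_or_nonempty S with hS | ⟨⟨s⟩⟩
      · have := ch.stateLaw_mem.2
        simp at this
      · have hK0 : 0 ≤ K := (hd s (Classical.arbitrary T)).trans (hK _ _)
        simpa using mul_nonneg hK0 hE
    · have hn' : (n : ℝ) ≠ 0 := by positivity
      rw [Finset.sum_const, Finset.card_univ, Fintype.card_fin, nsmul_eq_mul]
      exact le_of_eq (by field_simp)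

end Codes

/-! ### The single-letter characterization of the region -/

section Region

theorem numMessages_pos (n : ℕ) (R : ℝ) : 0 < numMessages n R :=
  Nat.ceil_pos.2 (by positivity)

theorem numMessages_zero (n : ℕ) : numMessages n 0 = 1 := by simp [numMessages]

instance nonempty_messages (n : ℕ) (R : ℝ) : Nonempty (Fin (numMessages n R)) :=
  ⟨⟨0, numMessages_pos n R⟩⟩

instance subsingleton_messages_zero (n : ℕ) : Subsingleton (Fin (numMessages n 0)) := by
  rw [numMessages_zero]; infer_instance

theorem card_messages (n : ℕ) (R : ℝ) :
    Fintype.card (Fin (numMessages n R) × Fin (numMessages n 0)) = numMessages n R := by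
  simp [numMessages_zero]

theorem mul_le_logb_numMessages (n : ℕ) (R : ℝ) :
    n * R ≤ Real.logb 2 (numMessages n R) := by
  rw [Real.le_logb_iff_rpow_le one_lt_two (by exact_mod_cast numMessages_pos n R)]
  exact Nat.le_ceil _

theorem exists_le_of_weighted_sum_le {ι : Type*} [Fintype ι] {p : ι → ℝ} (hp : p ∈ stdSimplex ℝ ι)
    {F : ι → ℝ} {b : ℝ} (h : ∑ i, p i * F i ≤ b) : ∃ i, F i ≤ b := by
  have hne : Nonempty ι := by
    by_contra hemp
    rw [not_nonempty_iff] at hemp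
    have := hp.2
    simp at this
  obtain ⟨i, hi⟩ := Finite.exists_min F
  refine ⟨i, le_trans ?_ h⟩
  rw [← one_mul (F i), ← hp.2, Finset.sum_mul]
  exact Finset.sum_le_sum fun j _ => mul_le_mul_of_nonneg_left (hi j) (hp.1 j)

theorem exists_dist_bound {S T : Type*} [Finite S] [Finite T] (d : S → T → ℝ) :
    ∃ K, 0 ≤ K ∧ ∀ s t, d s t ≤ K := by
  obtain ⟨K, hK⟩ := (Set.finite_range fun c : S × T => d c.1 c.2).bddAbove
  exact ⟨max K 0, le_max_right _ _, fun s t => (hK ⟨(s, t), rfl⟩).trans (le_max_left _ _)⟩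

variable {X S Y Z T : Type*} [Fintype X] [Fintype S] [Fintype Y] [Fintype Z] (ch : Channel X S Y Z)

/-- The rate constraints that the empirical input law of a code satisfies. -/
theorem Code.converse [DecidableEq X] {n : ℕ} (hn : 0 < n) {R : ℝ}
    (c : Code X S Y Z T (numMessages n R) (numMessages n 0) n) (hc : c.errorProb ch ≤ 1) :
    (1 - c.errorProb ch) * R ≤ info (empLaw c.enc) (commChannel ch) + (n : ℝ)⁻¹ ∧
      (1 - c.errorProb ch) * R ≤ info (empLaw c.enc) (sensChannel ch) + (n : ℝ)⁻¹ := by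
  have hn0 : (0 : ℝ) < n := by exact_mod_cast hn
  have key : ∀ e I : ℝ, e ≤ c.errorProb ch →
      (1 - e) * Real.logb 2 (numMessages n R) ≤ n * I + 1 →
      (1 - c.errorProb ch) * R ≤ I + (n : ℝ)⁻¹ := by
    intro e I he h
    have hlog : 0 ≤ Real.logb 2 (numMessages n R) :=
      Real.logb_nonneg one_lt_two (by exact_mod_cast numMessages_pos n R)
    have h1 := mul_le_mul_of_nonneg_left (mul_le_logb_numMessages n R) (sub_nonneg.2 hc)
    have h2 := mul_le_mul_of_nonneg_right (sub_le_sub_left he 1) hlog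
    refine le_of_mul_le_mul_left ?_ hn0
    rw [mul_add, mul_inv_cancel₀ hn0.ne']
    linarith
  have hg : ∀ (z : Fin n → Z) (w : Fin (numMessages n R) × Fin (numMessages n 0)),
      (c.dec₂ z, Classical.arbitrary (Fin (numMessages n 0))) ≠ w ↔ c.dec₂ z ≠ w.1 := fun z w => by
    rw [Ne, Prod.ext_iff]
    simp [eq_iff_true_of_subsingleton]
  constructor
  · refine key _ _ (c.avgError_commChannel_le_errorProb ch) ?_
    have := one_sub_avgError_mul_log_card_le (commChannel_mem ch) hn c.enc
      fun b => c.dec₁ (fun i => (b i).1) fun i => (b i).2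
    rwa [card_messages] at this
  · refine key _ _ (c.avgError_sensChannel_le_errorProb ch _ hg) ?_
    have := one_sub_avgError_mul_log_card_le (sensChannel_mem ch) hn c.enc
      fun z => (c.dec₂ z, Classical.arbitrary (Fin (numMessages n 0)))
    rwa [card_messages] at this

variable [Finite T] [Nonempty T]

theorem cost_nonneg {d : S → T → ℝ} (hd : ∀ s t, 0 ≤ d s t) (x : X) : 0 ≤ cost ch d x :=
  Finset.sum_nonneg fun s _ => Finset.sum_nonneg fun z _ =>
    mul_nonneg (stateLaw_mul_transZ_nonneg ch x s z) (hd _ _)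

/-- The set of pairs `(R, D)` that the single-letter bounds allow. -/
def singleLetterRegion (d : S → T → ℝ) : Set (ℝ × ℝ) :=
  {q | ∃ P ∈ stdSimplex ℝ X, ∑ x, P x * cost ch d x ≤ q.2 ∧
    q.1 ≤ info P (commChannel ch) ∧ q.1 ≤ info P (sensChannel ch)}

theorem isClosed_singleLetterRegion (d : S → T → ℝ) : IsClosed (singleLetterRegion ch d) := by
  refine IsSeqClosed.isClosed fun q q' hq hlim => ?_
  choose P hP hcost hcomm hsens using hq
  obtain ⟨P', hP', φ, hφ, hPlim⟩ := (isCompact_stdSimplex ℝ X).tendsto_subseq hP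
  have hq1 := (continuous_fst.tendsto q').comp (hlim.comp hφ.tendsto_atTop)
  have hq2 := (continuous_snd.tendsto q').comp (hlim.comp hφ.tendsto_atTop)
  have hcont : Continuous fun P : X → ℝ => ∑ x, P x * cost ch d x := by fun_prop
  exact ⟨P', hP',
    le_of_tendsto_of_tendsto' ((hcont.tendsto P').comp hPlim) hq2 fun k => hcost _,
    le_of_tendsto_of_tendsto' hq1 (((continuous_info _).tendsto P').comp hPlim) fun k => hcomm _,
    le_of_tendsto_of_tendsto' hq1 (((continuous_info _).tendsto P').comp hPlim) fun k => hsens _⟩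

/-- Converse: a limit point of the empirical input laws of good codes satisfies the single-letter
constraints. -/
theorem Achievable.mem_singleLetterRegion {d : S → T → ℝ} {R D : ℝ}
    (h : Achievable ch d R 0 D) : (R, D) ∈ singleLetterRegion ch d := by
  classical
  obtain ⟨-, -, c, herr, hdist⟩ := h
  let P : ℕ → X → ℝ := fun k => empLaw (c (k + 1)).enc
  obtain ⟨P', hP', φ, hφ, hPlim⟩ := (isCompact_stdSimplex ℝ X).tendsto_subseq
    fun k => (empLaw_mem k.succ_pos (c (k + 1)).enc : P k ∈ stdSimplex ℝ X)
  have hsub : Tendsto (fun k => φ k + 1) atTop atTop :=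
    (tendsto_add_atTop_nat 1).comp hφ.tendsto_atTop
  have herr' := herr.comp hsub
  have hinv : Tendsto (fun k => ((φ k + 1 : ℕ) : ℝ)⁻¹) atTop (𝓝 0) :=
    tendsto_inv_atTop_nhds_zero_nat.comp hsub
  have hleft : Tendsto (fun k => (1 - (c (φ k + 1)).errorProb ch) * R) atTop (𝓝 R) := by
    simpa using (herr'.const_sub 1).mul_const R
  have hone : ∀ᶠ k in atTop, (c (φ k + 1)).errorProb ch ≤ 1 :=
    (herr'.eventually_lt_const one_pos).mono fun k hk => hk.le
  have hcont : Continuous fun P : X → ℝ => ∑ x, P x * cost ch d x := by fun_prop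
  refine ⟨P', hP', ?_, ?_, ?_⟩
  · obtain ⟨K, hK0, hK⟩ := exists_dist_bound d
    refine le_of_forall_pos_lt_add fun δ hδ => ?_
    -- The limit superior of reals is meaningful because the distortion is bounded.
    have hbdd : IsBoundedUnder (· ≤ ·) atTop fun n => (c n).distortion ch d :=
      isBoundedUnder_of ⟨K, fun n => (c n).distortion_le ch hK0 hK⟩
    have hev := hsub.eventually (eventually_lt_of_limsup_lt
      (show limsup (fun n => (c n).distortion ch d) atTop < D + δ / 2 by linarith) hbdd)
    have hle : ∑ x, P' x * cost ch d x ≤ D + δ / 2 :=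
      le_of_tendsto ((hcont.tendsto P').comp hPlim) (hev.mono fun k hk =>
        ((c (φ k + 1)).sum_empLaw_mul_cost_le_distortion ch d).trans hk.le)
    change _ < D + δ
    linarith
  · have hr := (((continuous_info (commChannel ch)).tendsto P').comp hPlim).add hinv
    rw [add_zero] at hr
    exact le_of_tendsto_of_tendsto hleft hr
      (hone.mono fun k hk => ((c (φ k + 1)).converse ch (φ k).succ_pos hk).1)
  · have hr := (((continuous_info (sensChannel ch)).tendsto P').comp hPlim).add hinv
    rw [add_zero] at hr
    exact le_of_tendsto_of_tendsto hleft hr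
      (hone.mono fun k hk => ((c (φ k + 1)).converse ch (φ k).succ_pos hk).2)

theorem fullDecodingRegion_subset (d : S → T → ℝ) :
    fullDecodingRegion ch d ⊆ singleLetterRegion ch d :=
  closure_minimal (fun _ h => Achievable.mem_singleLetterRegion ch h)
    (isClosed_singleLetterRegion ch d)

/-- The code with codebook `x` whose decoders use maximum likelihood, and whose estimator applies
the optimal single-letter estimator to the decoded codeword and the sensing output. -/
noncomputable def mlCode (d : S → T → ℝ) {M₀ M₁ n : ℕ} [Nonempty (Fin M₀)] [Nonempty (Fin M₁)]
    (x : Fin M₀ × Fin M₁ → Fin n → X) : Code X S Y Z T M₀ M₁ n where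
  enc := x
  dec₁ y s := mlDecoder (blockChannel (commChannel ch) n) x fun i => (y i, s i)
  dec₂ z := (mlDecoder (blockChannel (sensChannel ch) n) x z).1
  est z i := optEstimator ch d (x (mlDecoder (blockChannel (sensChannel ch) n) x z) i) (z i)

/-- Achievability. For i.i.d. codebooks the mean error probability tends to `0`, and the mean
distortion is at most `∑ x, P x * cost x` up to a multiple of the mean error probability. A single
codebook is good for both, because it is picked by the average of distortion plus `κ` times the
error probability, with `κ → ∞` so slowly that the second average still vanishes; no concentration
of the distortion is needed. -/
theorem achievable_of_lt_info {d : S → T → ℝ} (hd : ∀ s t, 0 ≤ d s t) {P : X → ℝ}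
    (hP : P ∈ stdSimplex ℝ X) {R D : ℝ} (hR : 0 ≤ R)
    (hcomm : R = 0 ∨ R < info P (commChannel ch)) (hsens : R = 0 ∨ R < info P (sensChannel ch))
    (hD : ∑ x, P x * cost ch d x ≤ D) : Achievable ch d R 0 D := by
  obtain ⟨K, hK0, hK⟩ := exists_dist_bound d
  obtain ⟨ε₁, hε₁, hE₁⟩ := exists_tendsto_sum_avgError_le hP (commChannel_mem ch) hR hcomm
  obtain ⟨ε₂, hε₂, hE₂⟩ := exists_tendsto_sum_avgError_le hP (sensChannel_mem ch) hR hsens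
  set C := ∑ x, P x * cost ch d x with hC
  have hC0 : 0 ≤ C := Finset.sum_nonneg fun x _ => mul_nonneg (hP.1 x) (cost_nonneg ch hd x)
  -- A strictly positive null sequence above the mean error probability; the weight `κ` is
  -- `(√(η n))⁻¹`, so that `κ * η n = √(η n)`.
  let η : ℕ → ℝ := fun n => |ε₁ n + ε₂ n| + ((n : ℝ) + 1)⁻¹
  have hη0 : ∀ n, 0 < η n := fun n => by positivity
  have hη : Tendsto η atTop (𝓝 0) := by
    have h1 := (hε₁.add hε₂).abs
    have h2 := tendsto_one_div_add_atTop_nhds_zero_nat (𝕜 := ℝ)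
    simpa [η] using h1.add h2
  have hsqrt : Tendsto (fun n => √(η n)) atTop (𝓝 0) := by
    have h := (Real.continuous_sqrt.tendsto 0).comp hη
    rwa [Real.sqrt_zero] at h
  let u : ℕ → ℝ := fun n => C + K * η n + √(η n)
  have hu : Tendsto u atTop (𝓝 C) := by
    simpa using ((hη.const_mul K).const_add C).add hsqrt
  have hcode : ∀ n, ∃ c : Code X S Y Z T (numMessages n R) (numMessages n 0) n,
      c.distortion ch d ≤ u n ∧ c.errorProb ch ≤ √(η n) * u n := by
    intro n
    let W := Fin (numMessages n R) × Fin (numMessages n 0)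
    let p : (W → Fin n → X) → ℝ := fun x => ∏ w, ∏ i, P (x w i)
    have hPn : ∑ x : Fin n → X, ∏ i, P (x i) = 1 := by
      rw [sum_pi_prod fun _ : Fin n => P]; simp [hP.2]
    have hp : p ∈ stdSimplex ℝ (W → Fin n → X) :=
      ⟨fun x => Finset.prod_nonneg fun w _ => Finset.prod_nonneg fun i _ => hP.1 _, by
        rw [sum_pi_prod fun (_ : W) (x : Fin n → X) => ∏ i, P (x i)]; simp [hPn]⟩
    let code : (W → Fin n → X) → Code X S Y Z T (numMessages n R) (numMessages n 0) n := mlCode ch d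
    have hg : ∀ x z (w : W), mlDecoder (blockChannel (sensChannel ch) n) x z ≠ w ↔
        (code x).dec₂ z ≠ w.1 := fun x z w => by
      rw [Ne, Prod.ext_iff]
      simp [eq_iff_true_of_subsingleton, code, mlCode]
    have herr : ∑ x, p x * (code x).errorProb ch ≤ η n := by
      have h1 := hE₁ n W (card_messages n R)
      have h2 := hE₂ n W (card_messages n R)
      have h3 : ∑ x, p x * (code x).errorProb ch ≤ ε₁ n + ε₂ n := by
        refine le_trans ?_ (add_le_add h1 h2)
        rw [← Finset.sum_add_distrib]
        refine Finset.sum_le_sum fun x _ => ?_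
        rw [← mul_add]
        exact mul_le_mul_of_nonneg_left ((code x).errorProb_le_add ch _ (hg x)) (hp.1 x)
      have h4 : (0 : ℝ) < ((n : ℝ) + 1)⁻¹ := by positivity
      have h5 := le_abs_self (ε₁ n + ε₂ n)
      dsimp only [η]
      linarith
    have hcost : ∑ x, p x * (((Fintype.card W : ℝ) * n)⁻¹ * ∑ w, ∑ i, cost ch d (x w i)) ≤ C := by
      have h1 : ∀ w i, ∑ x : W → Fin n → X, p x * cost ch d (x w i) = C := by
        intro w i
        rw [sum_pi_prod_mul_coord_of_sum_eq_one (fun (_ : W) (x : Fin n → X) => ∏ i, P (x i))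
          (fun _ => hPn) w fun x => cost ch d (x i)]
        exact sum_pi_prod_mul_coord_of_sum_eq_one (fun _ => P) (fun _ => hP.2) i (cost ch d)
      have h2 : ∑ x, p x * (((Fintype.card W : ℝ) * n)⁻¹ * ∑ w, ∑ i, cost ch d (x w i)) =
          ((Fintype.card W : ℝ) * n)⁻¹ *
            ∑ w : W, ∑ i : Fin n, ∑ x, p x * cost ch d (x w i) := by
        rw [Finset.sum_congr rfl fun w _ => Finset.sum_comm, Finset.sum_comm, Finset.mul_sum]
        refine Finset.sum_congr rfl fun x _ => ?_
        simp only [← Finset.mul_sum]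
        ring
      rw [h2]
      simp only [h1, Finset.sum_const, Finset.card_univ, Fintype.card_fin (n := n), nsmul_eq_mul]
      rw [← mul_assoc, ← mul_assoc, mul_assoc _ (Fintype.card W : ℝ)]
      -- For `n = 0` the normalizing factor is `0⁻¹ = 0`, hence an inequality.
      exact mul_le_of_le_one_left hC0 inv_mul_le_one
    have hdist : ∑ x, p x * (code x).distortion ch d ≤ C + K * η n := by
      refine le_trans ?_ (add_le_add hcost (mul_le_mul_of_nonneg_left herr hK0))
      rw [Finset.mul_sum, ← Finset.sum_add_distrib]
      refine Finset.sum_le_sum fun x _ => ?_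
      rw [mul_left_comm K, ← mul_add]
      exact mul_le_mul_of_nonneg_left
        ((code x).distortion_le_of_est_eq ch hd hK _ (hg x) fun z i => rfl) (hp.1 x)
    have hs : 0 < √(η n) := Real.sqrt_pos.2 (hη0 n)
    have htot : ∑ x, p x * ((code x).distortion ch d + (√(η n))⁻¹ * (code x).errorProb ch) ≤
        u n := by
      have h1 : (√(η n))⁻¹ * η n = √(η n) := by
        rw [inv_mul_eq_div, Real.div_sqrt]
      have h2 := mul_le_mul_of_nonneg_left herr (inv_nonneg.2 hs.le)
      rw [h1] at h2
      refine le_trans (le_of_eq ?_) (add_le_add hdist h2)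
      rw [Finset.mul_sum, ← Finset.sum_add_distrib]
      refine Finset.sum_congr rfl fun x _ => ?_
      ring
    obtain ⟨x, hx⟩ := exists_le_of_weighted_sum_le hp htot
    have he := (code x).errorProb_nonneg ch
    have hd' := (code x).distortion_nonneg ch hd
    have he' : 0 ≤ (√(η n))⁻¹ * (code x).errorProb ch := mul_nonneg (inv_nonneg.2 hs.le) he
    refine ⟨code x, by linarith, ?_⟩
    rw [← inv_mul_le_iff₀ hs]
    linarith
  choose c hcd hce using hcode
  refine ⟨hR, le_rfl, c, ?_, ?_⟩
  · exact squeeze_zero (fun n => (c n).errorProb_nonneg ch) hce (by simpa using hsqrt.mul hu)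
  · refine le_trans ?_ hD
    rw [← hu.limsup_eq]
    refine limsup_le_limsup (Eventually.of_forall hcd) ?_ hu.isBoundedUnder_le
    exact (isBoundedUnder_of ⟨0, fun n => (c n).distortion_nonneg ch hd⟩ :
      IsBoundedUnder (· ≥ ·) atTop _).isCoboundedUnder_le

theorem mem_fullDecodingRegion {d : S → T → ℝ} (hd : ∀ s t, 0 ≤ d s t) {P : X → ℝ} {D : ℝ}
    (hP : P ∈ inputLaws ch d D) :
    (min (info P (commChannel ch)) (info P (sensChannel ch)), D) ∈ fullDecodingRegion ch d := by
  set r := min (info P (commChannel ch)) (info P (sensChannel ch)) with hr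
  have hr0 : 0 ≤ r :=
    le_min (info_nonneg hP.1 (commChannel_mem ch)) (info_nonneg hP.1 (sensChannel_mem ch))
  -- At `r = 0` there is no smaller rate to approximate with, but rate `0` itself is achievable.
  rcases hr0.eq_or_lt with h0 | hpos
  · rw [← h0]
    exact subset_closure
      (achievable_of_lt_info ch hd hP.1 le_rfl (Or.inl rfl) (Or.inl rfl) hP.2)
  · have hmem : r ∈ closure (Set.Ico 0 r) := by
      rw [closure_Ico hpos.ne]
      exact ⟨hr0, le_rfl⟩
    have himg := image_closure_subset_closure_image
      (show Continuous fun t : ℝ => (t, D) by fun_prop) (Set.mem_image_of_mem _ hmem)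
    refine closure_mono ?_ himg
    rintro _ ⟨t, ht, rfl⟩
    exact achievable_of_lt_info ch hd hP.1 ht.1 (Or.inr (ht.2.trans_le (min_le_left _ _)))
      (Or.inr (ht.2.trans_le (min_le_right _ _))) hP.2

theorem isCompact_inputLaws (d : S → T → ℝ) (D : ℝ) : IsCompact (inputLaws ch d D) := by
  have hcont : Continuous fun P : X → ℝ => ∑ x, P x * cost ch d x := by fun_prop
  exact (isCompact_stdSimplex ℝ X).inter_right (isClosed_le hcont continuous_const)

end Region

end ISAC

theorem corollary2 {X S Y Z T : Type*} [Fintype X] [Fintype S] [Fintype Y] [Fintype Z]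
    [Finite T] [Nonempty T] (ch : ISAC.Channel X S Y Z)
    (d : S → T → ℝ) (hd : ∀ s t, 0 ≤ d s t) (D : ℝ) :
    ((ISAC.fullDecodingRates ch d D).Nonempty ↔ (ISAC.inputLaws ch d D).Nonempty) ∧
    ((ISAC.inputLaws ch d D).Nonempty →
      IsGreatest (ISAC.fullDecodingRates ch d D) (ISAC.capacity ch d D) ∧
      IsGreatest
        ((fun P : X → ℝ => min (ISAC.infoXYgivenS ch P) (ISAC.infoXZ ch P)) ''
          ISAC.inputLaws ch d D)
        (ISAC.capacity ch d D)) := by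
  have hconv : ∀ R ∈ ISAC.fullDecodingRates ch d D, ∃ P ∈ ISAC.inputLaws ch d D,
      R ≤ min (ISAC.info P (ISAC.commChannel ch)) (ISAC.info P (ISAC.sensChannel ch)) := by
    intro R hR
    obtain ⟨P, hP, hcost, hcomm, hsens⟩ := ISAC.fullDecodingRegion_subset ch d hR
    exact ⟨P, ⟨hP, hcost⟩, le_min hcomm hsens⟩
  refine ⟨⟨fun ⟨R, hR⟩ => ?_, fun ⟨P, hP⟩ => ⟨_, ISAC.mem_fullDecodingRegion ch hd hP⟩⟩,
    fun hne => ?_⟩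
  · obtain ⟨P, hP, -⟩ := hconv R hR
    exact ⟨P, hP⟩
  obtain ⟨P, hP, hmax⟩ := (ISAC.isCompact_inputLaws ch d D).exists_isMaxOn hne
    ((ISAC.continuous_info (ISAC.commChannel ch)).min
      (ISAC.continuous_info (ISAC.sensChannel ch))).continuousOn
  have hgreat : IsGreatest (ISAC.fullDecodingRates ch d D)
      (min (ISAC.info P (ISAC.commChannel ch)) (ISAC.info P (ISAC.sensChannel ch))) := by
    refine ⟨ISAC.mem_fullDecodingRegion ch hd hP, fun R hR => ?_⟩
    obtain ⟨P', hP', hle⟩ := hconv R hR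
    exact hle.trans (hmax hP')
  have hcap : ISAC.capacity ch d D = _ := hgreat.csSup_eq
  rw [hcap]
  refine ⟨hgreat, ⟨P, hP, ?_⟩, ?_⟩
  · simp only [ISAC.infoXYgivenS_eq_info ch hP.1, ISAC.infoXZ_eq_info ch hP.1]
  · rintro _ ⟨P', hP', rfl⟩
    simp only [ISAC.infoXYgivenS_eq_info ch hP'.1, ISAC.infoXZ_eq_info ch hP'.1]
    exact hmax hP'
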